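/- Let $m=N-2\ge 0$, let $W\subset\mathbb R^{m}$ be open, and let $\alpha_{kl},\beta_{klj}\in C^\infty(W)$ with $\alpha_{kl}=\alpha_{lk}$; write $\beta_{kl}(\mathbf w,\partial_x\mathbf w)=\sum_j\beta_{klj}(\mathbf w)\,\partial_x w_j$. Consider fields $(\rho,u,w_1,\dots,w_m)$ on the line with $\rho>0$ and $\mathbf w\in W$, local functionals $F=\int f\,dx$ whose density $f$ is a smooth function of $x$, the fields and finitely many of their $x$-derivatives (densities that differ by a total $x$-derivative of such a function are identified, since boundary terms vanish), and functional derivatives $F_\rho,F_u,F_k=\delta F/\delta w_k$. The partially decoupled bracket of hydrodynamic type is $$\{F,G\}=\int\Big(\partial_xF_u\,G_\rho-F_\rho\,\partial_xG_u+\partial_xw_k\Big(F_u\frac{G_k}{\rho}-\frac{F_k}{\rho}G_u\Big)+\partial_x\Big(\frac{F_k}{\rho}\Big)\alpha_{kl}(\mathbf w)\frac{G_l}{\rho}+\frac{F_k}{\rho}\,\beta_{kl}(\mathbf w,\partial_x\mathbf w)\,\frac{G_l}{\rho}\Big)dx,$$ with sums over $k,l=1,\dots,m$. Assume that it is a Poisson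 bracket (antisymmetric, with the Jacobi identity) and that it is non-degenerate: written as $\int(\partial_xF_n A_{nm}G_m+F_nB_{nm}G_m)\,dx$ in all $N$ fields, the matrix $A$ is invertible at all admissible field values. Then: 1. Every point of $W$ has an open neighbourhood $V\subset W$ with flat coordinates of the microscopic bracket $\int(\partial_xF_k\,\alpha_{kl}G_l+F_k\beta_{kl}G_l)\,dx$, i.e. an injective smooth map $\boldsymbol\nu:V\to\mathbb R^{m}$ with invertible Jacobian matrix $J=\partial\boldsymbol\nu/\partial\mathbf w$ and a constant symmetric invertible matrix $g$ with $J\alpha J^{t}=g$ on $V$. 2. For every open $V\subset W$ and every smooth $\boldsymbol\nu:V\to\mathbb R^m$ with $J$ invertible and $J\alpha J^{t}=g$ on $V$, where $g$ is a constant symmetric invertible matrix, the $\beta$-part of the microscopic bracket in the variables $\boldsymbol\nu$ vanishes, and the $N$ functionals $$\int\rho\,dx,\qquad \int\Big(u-\frac{\rho}{2}\,\boldsymbol\nu\cdot g^{-1}\boldsymbol\nu\Big)dx,\qquad \int\rho\,\nu_k\,dx\quad(k=1,\dots,N-2)$$ are Casimir invariants on the fields with $\rho>0$, $\mathbf w\in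 V$: their bracket with every local functional is zero. They are independent: their functional derivatives are linearly independent vectors of $\mathbb R^N$ at every position and for all admissible fields. -/

import Mathlib

open scoped ContDiff

namespace HydroBracket

/-! ### Local functionals of fields on the line (formal calculus of variations) -/

/-- The jets at one point of fields `u i`, `i : ι`, on the line: `z n i` stands for `∂ₓⁿ u i`. -/
abbrev Jet (ι : Type) : Type := ℕ → ι → ℝ

/-- A density is a function of the position `x` and of the jet of the fields. -/
abbrev Density (ι : Type) : Type := ℝ → Jet ι → ℝ

/-- `f` is a differential function on the set `Ω` of admissible field values: as long as the values
of the fields are in `Ω`, it is a smooth function of `x`, the fields and finitely many of their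
derivatives. -/
def IsDiffFun {ι : Type} [Fintype ι] (Ω : Set (ι → ℝ)) (f : Density ι) : Prop :=
  ∃ (n : ℕ) (φ : ℝ × (Fin (n + 1) → ι → ℝ) → ℝ),
    ContDiffOn ℝ ∞ φ {p | p.2 0 ∈ Ω} ∧
      ∀ (x : ℝ) (z : Jet ι), z 0 ∈ Ω → f x z = φ (x, fun j => z j)

/-- The partial derivative of `f` with respect to the jet variable `∂ₓⁿ u i`. -/
noncomputable def jetDeriv {ι : Type} [DecidableEq ι] (n : ℕ) (i : ι) (f : Density ι) :
    Density ι :=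
  fun x z => lineDeriv ℝ (f x) z (Pi.single n (Pi.single i 1))

/-- The total derivative `∂ₓ`; for a differential function the sum over `n` is finite. -/
noncomputable def totalDeriv {ι : Type} [Fintype ι] [DecidableEq ι] (f : Density ι) : Density ι :=
  fun x z => deriv (fun s => f s z) x + ∑ᶠ n : ℕ, ∑ i, z (n + 1) i * jetDeriv n i f x z

/-- The functional derivative `δF/δ(u i) = ∑ₙ (-∂ₓ)ⁿ (∂f/∂(∂ₓⁿ u i))` of `F = ∫ f dx`; for a
differential function the sum over `n` is finite. -/
noncomputable def varDeriv {ι : Type} [Fintype ι] [DecidableEq ι] (i : ι) (f : Density ι) :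
    Density ι :=
  fun x z => ∑ᶠ n : ℕ, (-1 : ℝ) ^ n * (totalDeriv^[n] (jetDeriv n i f)) x z

/-- `∫ f dx = 0` as a functional, boundary terms at infinity being zero: `f` is the total derivative
of a differential function. A local functional `∫ f dx` is the class of `f` for this relation. -/
def IntegralZero {ι : Type} [Fintype ι] [DecidableEq ι] (Ω : Set (ι → ℝ)) (f : Density ι) : Prop :=
  ∃ h : Density ι, IsDiffFun Ω h ∧ ∀ (x : ℝ) (z : Jet ι), z 0 ∈ Ω → f x z = totalDeriv h x z

/-- A bracket of local functionals (given on densities) is a Poisson bracket: it is antisymmetric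
and satisfies the Jacobi identity. -/
structure IsPoisson {ι : Type} [Fintype ι] [DecidableEq ι] (Ω : Set (ι → ℝ))
    (br : Density ι → Density ι → Density ι) : Prop where
  antisymm : ∀ f g : Density ι, IsDiffFun Ω f → IsDiffFun Ω g →
    IntegralZero Ω (fun x z => br f g x z + br g f x z)
  jacobi : ∀ f g h : Density ι, IsDiffFun Ω f → IsDiffFun Ω g → IsDiffFun Ω h →
    IntegralZero Ω (fun x z => br f (br g h) x z + br g (br h f) x z + br h (br f g) x z)

/-- `∫ c dx` is a Casimir invariant: an observable whose bracket with every observable vanishes. -/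
def IsCasimir {ι : Type} [Fintype ι] [DecidableEq ι] (Ω : Set (ι → ℝ))
    (br : Density ι → Density ι → Density ι) (c : Density ι) : Prop :=
  IsDiffFun Ω c ∧ ∀ f : Density ι, IsDiffFun Ω f → IntegralZero Ω (br c f)

/-- The functionals `∫ c a dx` are independent: at every jet of admissible fields their
functional derivatives are linearly independent. -/
def AreIndependent {ι κ : Type} [Fintype ι] [DecidableEq ι] (Ω : Set (ι → ℝ))
    (c : κ → Density ι) : Prop :=
  ∀ (x : ℝ) (z : Jet ι), z 0 ∈ Ω →
    LinearIndependent ℝ (fun (a : κ) (i : ι) => varDeriv i (c a) x z)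

/-! ### Partially decoupled brackets

The `N = m + 2` fields are indexed by `Fin 2 ⊕ Fin m`. -/

/-- The index of the field `ρ`. -/
abbrev iρ {m : ℕ} : Fin 2 ⊕ Fin m := Sum.inl 0

/-- The index of the field `u`. -/
abbrev iu {m : ℕ} : Fin 2 ⊕ Fin m := Sum.inl 1

/-- The index of the field `w k`. -/
abbrev iw {m : ℕ} (k : Fin m) : Fin 2 ⊕ Fin m := Sum.inr k

/-- The values of the fields `w` in a jet of `(ρ, u, w)`. -/
def wval {m : ℕ} (z : Jet (Fin 2 ⊕ Fin m)) : Fin m → ℝ := fun k => z 0 (iw k)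

/-- The admissible field values `(ρ, u, w)`: `ρ > 0` and `w ∈ W`. -/
def fieldDomain {m : ℕ} (W : Set (Fin m → ℝ)) : Set (Fin 2 ⊕ Fin m → ℝ) :=
  {v | 0 < v iρ ∧ (fun k => v (iw k)) ∈ W}

/-- The partially decoupled bracket of hydrodynamic type with microscopic coefficients `α k l` and
`β k l = ∑ j, β k l j ∂ₓ w j`:
`{F,G} = ∫ ∂ₓF_u G_ρ - F_ρ ∂ₓG_u + ∂ₓw_k (F_u G_k/ρ - F_k/ρ G_u)`
`+ ∂ₓ(F_k/ρ) α_kl(w) G_l/ρ + F_k/ρ β_kl(w,∂ₓw) G_l/ρ dx`. -/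
noncomputable def decBracket {m : ℕ} (α : (Fin m → ℝ) → Matrix (Fin m) (Fin m) ℝ)
    (β : (Fin m → ℝ) → Fin m → Fin m → Fin m → ℝ)
    (f g : Density (Fin 2 ⊕ Fin m)) : Density (Fin 2 ⊕ Fin m) :=
  fun x z =>
    totalDeriv (varDeriv iu f) x z * varDeriv iρ g x z
    - varDeriv iρ f x z * totalDeriv (varDeriv iu g) x z
    + ∑ k, z 1 (iw k) * (varDeriv iu f x z * (varDeriv (iw k) g x z / z 0 iρ)
        - varDeriv (iw k) f x z / z 0 iρ * varDeriv iu g x z)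
    + ∑ k, ∑ l,
        (totalDeriv (fun x z => varDeriv (iw k) f x z / z 0 iρ) x z
            * α (wval z) k l * (varDeriv (iw l) g x z / z 0 iρ)
          + varDeriv (iw k) f x z / z 0 iρ
            * (∑ j, β (wval z) k l j * z 1 (iw j)) * (varDeriv (iw l) g x z / z 0 iρ))

/-- The matrix of the coefficients of `∂ₓF_n G_m` in the partially decoupled bracket, written in the
form `∫ ∂ₓF_n A_nm G_m + F_n B_nm G_m dx` of a bracket of hydrodynamic type in the fields
`(ρ, u, w)` (after an integration by parts, `- F_ρ ∂ₓG_u` contributes `∂ₓF_ρ G_u`). -/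
noncomputable def decMetric {m : ℕ} (α : (Fin m → ℝ) → Matrix (Fin m) (Fin m) ℝ)
    (v : Fin 2 ⊕ Fin m → ℝ) : Matrix (Fin 2 ⊕ Fin m) (Fin 2 ⊕ Fin m) ℝ :=
  Matrix.fromBlocks !![0, 1; 1, 0] 0 0 ((1 / v iρ ^ 2) • α (fun k => v (iw k)))

/-! ### Flat coordinates of the microscopic bracket -/

/-- The Jacobian matrix `∂(ν k)/∂(w n)`. -/
noncomputable def jacobian {m : ℕ} (ν : (Fin m → ℝ) → Fin m → ℝ) (w : Fin m → ℝ) :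
    Matrix (Fin m) (Fin m) ℝ :=
  Matrix.of fun k n => fderiv ℝ (fun w' => ν w' k) w (Pi.single n 1)

/-- `ν = ν(w)` is a smooth, locally invertible change of variables on `V` that transforms the metric
`α` of the microscopic bracket into the constant non-degenerate metric `g`. -/
structure IsFlatCoord {m : ℕ} (α : (Fin m → ℝ) → Matrix (Fin m) (Fin m) ℝ)
    (V : Set (Fin m → ℝ)) (ν : (Fin m → ℝ) → Fin m → ℝ) (g : Matrix (Fin m) (Fin m) ℝ) :
    Prop where
  smooth : ContDiffOn ℝ ∞ ν V
  invertible : ∀ w ∈ V, (jacobian ν w).det ≠ 0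
  symm : g.IsSymm
  nondeg : g.det ≠ 0
  flat : ∀ w ∈ V, jacobian ν w * α w * (jacobian ν w).transpose = g

/-- The coefficients `β k l j` of the microscopic bracket in the variables `ν`, still expanded in
`∂ₓ w j`: `∂ₓ(∂ν_k/∂w_p) α_pq ∂ν_l/∂w_q + ∂ν_k/∂w_p β_pq ∂ν_l/∂w_q`. -/
noncomputable def transformedBeta {m : ℕ} (α : (Fin m → ℝ) → Matrix (Fin m) (Fin m) ℝ)
    (β : (Fin m → ℝ) → Fin m → Fin m → Fin m → ℝ)
    (ν : (Fin m → ℝ) → Fin m → ℝ) (w : Fin m → ℝ) (k l j : Fin m) : ℝ :=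
  ∑ p, ∑ q, (fderiv ℝ (fun w' => jacobian ν w' k p) w (Pi.single j 1) * α w p q * jacobian ν w l q
    + jacobian ν w k p * β w p q j * jacobian ν w l q)

/-! ### The densities of the Casimir invariants -/

/-- The density `ρ`. -/
def rhoDensity {m : ℕ} : Density (Fin 2 ⊕ Fin m) := fun _ z => z 0 iρ

/-- The density `u - (ρ/2) ν · g⁻¹ ν`. -/
noncomputable def psiDensity {m : ℕ} (ν : (Fin m → ℝ) → Fin m → ℝ)
    (g : Matrix (Fin m) (Fin m) ℝ) : Density (Fin 2 ⊕ Fin m) :=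
  fun _ z => z 0 iu - z 0 iρ / 2 * (ν (wval z) ⬝ᵥ g⁻¹.mulVec (ν (wval z)))

/-- The density `ρ ν_k`. -/
def rhoNuDensity {m : ℕ} (ν : (Fin m → ℝ) → Fin m → ℝ) (k : Fin m) :
    Density (Fin 2 ⊕ Fin m) :=
  fun _ z => z 0 iρ * ν (wval z) k

end HydroBracket

open HydroBracket

/-! The microscopic bracket is geometric: `α` is a contravariant metric, and the matrices `Γ_j =
-β_j α⁻¹` define a connection on covector fields. The Poisson property of the full bracket forces
this connection to be metric, torsion free and flat. Such a metric has flat coordinates, and in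
these the Casimir equation can be solved explicitly.

Geometry from the Poisson property. The test functionals `∫ b ρ w_k dx` turn the bracket into
expressions in `α` and `β` only. Antisymmetry gives `β_klj + β_lkj = ∂_j α_kl`. The Jacobi identity,
with coefficients depending on `x` chosen to isolate single terms, gives vanishing torsion and
curvature. Each time the density known to have zero integral has the form `ψ(ρ) T(x, w, ∂ₓw)` with
`ψ` strictly monotone, after removal of a total derivative in the antisymmetric case. Raising `ρ` on
a small interval changes such an integral unless `T = 0`; this is `eq_zero_of_integralZero`, and it
makes the identities pointwise.

Existence of flat coordinates. One solves `∂_j ν = θ_j`, `∂_j θ_p = ∑_r Γ_jrp θ_r`. The first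
equation is integrable because the torsion vanishes, the second because the curvature does. The
linear Frobenius theorem `exists_solution_of_integrable` then gives solutions on one ball for all
initial covectors. Scalar products of parallel covector fields are constant, so `J α Jᵗ` is
constant; starting from the standard basis makes `J` the identity at the base point, and the inverse
function theorem gives injectivity.

Arbitrary flat coordinates. The transformed `β` is antisymmetric in its first two indices and, with
the last index raised, symmetric in its last two. As in the uniqueness of the Levi-Civita
connection, it vanishes.

Casimirs. By `isCasimir_affineDensity`, `∫ (ε u + ρ R(w)) dx` is a Casimir if `∑_k (∂_j ∂_k R α_kl +
∂_k R β_klj) = -ε δ_jl`. Constants and the `ν_k` solve this for `ε = 0`, and `-½ ν·g⁻¹ν` solves it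
for `ε = 1`, since `Jᵗ g⁻¹ J = α⁻¹`. -/

namespace HydroBracket

/-! ### Calculus of differential functions -/

section Calculus

set_option linter.unusedSectionVars false

variable {ι : Type} [Fintype ι] {Ω : Set (ι → ℝ)} {f g : Density ι}

/-- The set of truncated jets over an open set of field values is open. -/
theorem isOpen_truncatedJets (hΩ : IsOpen Ω) (n : ℕ) :
    IsOpen {p : ℝ × (Fin (n + 1) → ι → ℝ) | p.2 0 ∈ Ω} :=
  hΩ.preimage (by fun_prop)

/-- A differential function of order at most `n`. -/
def IsDiffFunOfOrder (Ω : Set (ι → ℝ)) (n : ℕ) (f : Density ι) : Prop :=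
  ∃ φ : ℝ × (Fin (n + 1) → ι → ℝ) → ℝ,
    ContDiffOn ℝ ∞ φ {p | p.2 0 ∈ Ω} ∧
      ∀ (x : ℝ) (z : Jet ι), z 0 ∈ Ω → f x z = φ (x, fun j => z j)

theorem IsDiffFun.exists_order (hf : IsDiffFun Ω f) : ∃ n, IsDiffFunOfOrder Ω n f := hf

theorem IsDiffFunOfOrder.mono {n k : ℕ} (hf : IsDiffFunOfOrder Ω n f) (h : n ≤ k) :
    IsDiffFunOfOrder Ω k f := by
  obtain ⟨φ, hφ, hfφ⟩ := hf
  refine ⟨fun p => φ (p.1, fun j => p.2 (Fin.castLE (by omega) j)), ?_, fun x z hz => ?_⟩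
  · refine hφ.comp (f := fun p : ℝ × (Fin (k + 1) → ι → ℝ) =>
      (p.1, fun j : Fin (n + 1) => p.2 (Fin.castLE (by omega) j))) ?_ ?_
    · exact ContDiff.contDiffOn (by fun_prop)
    · intro p hp
      exact hp
  · rw [hfφ x z hz]
    rfl

theorem IsDiffFun.congr (hf : IsDiffFun Ω f) (h : ∀ x z, z 0 ∈ Ω → g x z = f x z) :
    IsDiffFun Ω g := by
  obtain ⟨n, φ, hφ, hfφ⟩ := hf
  exact ⟨n, φ, hφ, fun x z hz => (h x z hz).trans (hfφ x z hz)⟩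

theorem IsDiffFun.exists_common_order (hf : IsDiffFun Ω f) (hg : IsDiffFun Ω g) :
    ∃ n, IsDiffFunOfOrder Ω n f ∧ IsDiffFunOfOrder Ω n g := by
  obtain ⟨n, hn⟩ := hf.exists_order
  obtain ⟨k, hk⟩ := hg.exists_order
  exact ⟨max n k, hn.mono (le_max_left _ _), hk.mono (le_max_right _ _)⟩

theorem IsDiffFun.add (hf : IsDiffFun Ω f) (hg : IsDiffFun Ω g) :
    IsDiffFun Ω (fun x z => f x z + g x z) := by
  obtain ⟨n, ⟨φ, hφ, hfφ⟩, ⟨ψ, hψ, hgψ⟩⟩ := hf.exists_common_order hg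
  exact ⟨n, fun p => φ p + ψ p, hφ.add hψ, fun x z hz => by simp only [hfφ x z hz, hgψ x z hz]⟩

theorem IsDiffFun.mul (hf : IsDiffFun Ω f) (hg : IsDiffFun Ω g) :
    IsDiffFun Ω (fun x z => f x z * g x z) := by
  obtain ⟨n, ⟨φ, hφ, hfφ⟩, ⟨ψ, hψ, hgψ⟩⟩ := hf.exists_common_order hg
  exact ⟨n, fun p => φ p * ψ p, hφ.mul hψ, fun x z hz => by simp only [hfφ x z hz, hgψ x z hz]⟩

/-- Densities that depend on the position and the field values only. -/
theorem IsDiffFun.of_zeroth {φ : ℝ × (ι → ℝ) → ℝ} (hφ : ContDiffOn ℝ ∞ φ {p | p.2 ∈ Ω}) :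
    IsDiffFun Ω (fun x z => φ (x, z 0)) := by
  refine ⟨0, fun p => φ (p.1, p.2 0), ?_, fun x z _ => rfl⟩
  refine hφ.comp (f := fun p : ℝ × (Fin 1 → ι → ℝ) => (p.1, p.2 0)) ?_ fun p hp => hp
  exact ContDiff.contDiffOn (by fun_prop)

theorem IsDiffFun.const (c : ℝ) : IsDiffFun Ω (fun _ _ => c) :=
  IsDiffFun.of_zeroth (φ := fun _ => c) contDiffOn_const

theorem IsDiffFun.neg (hf : IsDiffFun Ω f) : IsDiffFun Ω (fun x z => -f x z) :=
  ((IsDiffFun.const (-1)).mul hf).congr fun x z _ => by ring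

theorem IsDiffFun.sub (hf : IsDiffFun Ω f) (hg : IsDiffFun Ω g) :
    IsDiffFun Ω (fun x z => f x z - g x z) :=
  (hf.add hg.neg).congr fun x z _ => by ring

theorem IsDiffFun.sum {κ : Type*} {s : Finset κ} {F : κ → Density ι}
    (hF : ∀ k ∈ s, IsDiffFun Ω (F k)) : IsDiffFun Ω (fun x z => ∑ k ∈ s, F k x z) := by
  classical
  induction s using Finset.induction_on with
  | empty => simpa using IsDiffFun.const 0
  | insert a s ha ih =>
    simp only [Finset.sum_insert ha]
    exact (hF a (Finset.mem_insert_self a s)).add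
      (ih fun k hk => hF k (Finset.mem_insert_of_mem hk))

theorem IsDiffFun.coord (n : ℕ) (i : ι) : IsDiffFun Ω (fun _ z => z n i) := by
  refine ⟨n, fun p => p.2 (Fin.last n) i, ContDiff.contDiffOn (by fun_prop), fun x z _ => ?_⟩
  simp

/-- The chain rule for a representative of a differential function. -/
theorem hasDerivAt_of_representative (hΩ : IsOpen Ω) {n : ℕ}
    {φ : ℝ × (Fin (n + 1) → ι → ℝ) → ℝ} (hφ : ContDiffOn ℝ ∞ φ {p | p.2 0 ∈ Ω})
    (hfφ : ∀ (x : ℝ) (z : Jet ι), z 0 ∈ Ω → f x z = φ (x, fun j => z j))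
    {γ : ℝ → ℝ} {Z : ℝ → Jet ι} {t a : ℝ} {v : Jet ι} (hγ : HasDerivAt γ a t)
    (hZ : ∀ k, HasDerivAt (fun s => Z s k) (v k) t) (hz : Z t 0 ∈ Ω) :
    HasDerivAt (fun s => f (γ s) (Z s))
      (fderiv ℝ φ (γ t, fun j => Z t j) (a, fun j => v j)) t := by
  have hev : ∀ᶠ s in nhds t, Z s 0 ∈ Ω :=
    (hZ 0).continuousAt.eventually (hΩ.mem_nhds hz)
  have hd : HasFDerivAt φ (fderiv ℝ φ (γ t, fun j => Z t j)) (γ t, fun j => Z t j) :=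
    ((hφ.contDiffAt ((isOpen_truncatedJets hΩ n).mem_nhds hz)).differentiableAt
      (by simp)).hasFDerivAt
  have hc : HasDerivAt (fun s => (γ s, fun j : Fin (n + 1) => Z s j)) (a, fun j => v j) t :=
    hγ.prodMk (hasDerivAt_pi.2 fun j => hZ j)
  refine (hd.comp_hasDerivAt t hc).congr_of_eventuallyEq ?_
  filter_upwards [hev] with s hs using hfφ _ _ hs

variable [DecidableEq ι]

theorem jetDeriv_of_representative (hΩ : IsOpen Ω) {n : ℕ}
    {φ : ℝ × (Fin (n + 1) → ι → ℝ) → ℝ} (hφ : ContDiffOn ℝ ∞ φ {p | p.2 0 ∈ Ω})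
    (hfφ : ∀ (x : ℝ) (z : Jet ι), z 0 ∈ Ω → f x z = φ (x, fun j => z j))
    (k : ℕ) (i : ι) {x : ℝ} {z : Jet ι} (hz : z 0 ∈ Ω) :
    jetDeriv k i f x z =
      fderiv ℝ φ (x, fun j => z j) (0, fun j => (Pi.single k (Pi.single i 1) : Jet ι) j) := by
  have h := hasDerivAt_of_representative (t := 0) (γ := fun _ => x) (a := 0)
    (Z := fun t => z + t • (Pi.single k (Pi.single i 1) : Jet ι))
    (v := Pi.single k (Pi.single i 1)) hΩ hφ hfφ (hasDerivAt_const _ _) ?_ (by simpa using hz)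
  · exact h.deriv.trans (by simp)
  · intro l
    simpa using ((hasDerivAt_id (0 : ℝ)).smul_const
      ((Pi.single k (Pi.single i 1) : Jet ι) l)).const_add (z l)

theorem jetDeriv_eq_zero_of_representative (hΩ : IsOpen Ω) {n : ℕ}
    {φ : ℝ × (Fin (n + 1) → ι → ℝ) → ℝ} (hφ : ContDiffOn ℝ ∞ φ {p | p.2 0 ∈ Ω})
    (hfφ : ∀ (x : ℝ) (z : Jet ι), z 0 ∈ Ω → f x z = φ (x, fun j => z j))
    {k : ℕ} (hk : n < k) (i : ι) {x : ℝ} {z : Jet ι} (hz : z 0 ∈ Ω) :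
    jetDeriv k i f x z = 0 := by
  rw [jetDeriv_of_representative hΩ hφ hfφ k i hz]
  have : (fun j : Fin (n + 1) => (Pi.single k (Pi.single i 1) : Jet ι) j) = 0 := by
    funext j
    rw [Pi.single_eq_of_ne (by have := j.2; omega)]
    rfl
  rw [this]
  exact map_zero _

/-- Jets have infinitely many components, so differentiation is done on a representative in finitely
many variables. Expanding a direction in the basis identifies the formal sum over all orders with an
honest Fréchet derivative, because `f` does not depend on orders above `n`. The direction given by
the shifted jet yields the total derivative. -/
theorem fderiv_representative_eq_sum (hΩ : IsOpen Ω) {n : ℕ}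
    {φ : ℝ × (Fin (n + 1) → ι → ℝ) → ℝ} (hφ : ContDiffOn ℝ ∞ φ {p | p.2 0 ∈ Ω})
    (hfφ : ∀ (x : ℝ) (z : Jet ι), z 0 ∈ Ω → f x z = φ (x, fun j => z j))
    {x : ℝ} {z : Jet ι} (hz : z 0 ∈ Ω) (a : ℝ) (v : Jet ι) :
    fderiv ℝ φ (x, fun j => z j) (a, fun j => v j) =
      a * deriv (fun s => f s z) x + ∑ᶠ k : ℕ, ∑ i, v k i * jetDeriv k i f x z := by
  have h1 : deriv (fun s => f s z) x = fderiv ℝ φ (x, fun j => z j) (1, 0) :=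
    (hasDerivAt_of_representative (γ := fun s => s) (Z := fun _ => z) (v := 0) hΩ hφ hfφ
      (hasDerivAt_id x) (fun k => hasDerivAt_const _ _) hz).deriv
  have h2 : (∑ᶠ k : ℕ, ∑ i, v k i * jetDeriv k i f x z)
      = ∑ k : Fin (n + 1), ∑ i, v k i * jetDeriv k i f x z := by
    rw [← Finset.sum_range (fun k => ∑ i, v k i * jetDeriv k i f x z)]
    refine finsum_eq_sum_of_support_subset _ fun k hk => ?_
    by_contra hkn
    refine hk (Finset.sum_eq_zero fun i _ => ?_)
    rw [jetDeriv_eq_zero_of_representative hΩ hφ hfφ (by simpa using hkn) i hz, mul_zero]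
  have h3 : ((a, fun j => v j) : ℝ × (Fin (n + 1) → ι → ℝ)) = a • (1, 0) +
      ∑ k : Fin (n + 1), ∑ i, v k i • (0, fun j : Fin (n + 1) =>
        (Pi.single (k : ℕ) (Pi.single i 1) : Jet ι) j) := by
    ext j i
    · simp [Prod.fst_sum]
    · simp only [Prod.snd_add, Prod.smul_snd, Prod.snd_sum, Pi.add_apply, Finset.sum_apply,
        Pi.smul_apply, smul_eq_mul]
      rw [Finset.sum_eq_single j, Finset.sum_eq_single i]
      · simp
      · intro b _ hb
        simp [hb.symm]
      · simp
      · intro b _ hb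
        refine Finset.sum_eq_zero fun i' _ => ?_
        rw [Pi.single_eq_of_ne (by simpa [Fin.ext_iff] using hb.symm)]
        simp
      · simp
  rw [h1, h2, h3, map_add, map_smul, map_sum, smul_eq_mul]
  congr 1
  refine Finset.sum_congr rfl fun k _ => ?_
  rw [map_sum]
  refine Finset.sum_congr rfl fun i _ => ?_
  rw [map_smul, smul_eq_mul, jetDeriv_of_representative hΩ hφ hfφ k i hz]

theorem totalDeriv_of_representative (hΩ : IsOpen Ω) {n : ℕ}
    {φ : ℝ × (Fin (n + 1) → ι → ℝ) → ℝ} (hφ : ContDiffOn ℝ ∞ φ {p | p.2 0 ∈ Ω})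
    (hfφ : ∀ (x : ℝ) (z : Jet ι), z 0 ∈ Ω → f x z = φ (x, fun j => z j))
    {x : ℝ} {z : Jet ι} (hz : z 0 ∈ Ω) :
    totalDeriv f x z = fderiv ℝ φ (x, fun j => z j) (1, fun j => z (j + 1)) := by
  rw [fderiv_representative_eq_sum hΩ hφ hfφ hz 1 (fun k => z (k + 1)), one_mul]
  rfl

/-- The total derivative is the derivative along every curve of jets whose velocity is the
shifted jet. -/
theorem IsDiffFun.hasDerivAt_totalDeriv (hΩ : IsOpen Ω) (hf : IsDiffFun Ω f) {Z : ℝ → Jet ι}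
    {x : ℝ} (hZ : ∀ k, HasDerivAt (fun s => Z s k) (Z x (k + 1)) x) (hz : Z x 0 ∈ Ω) :
    HasDerivAt (fun s => f s (Z s)) (totalDeriv f x (Z x)) x := by
  obtain ⟨n, φ, hφ, hfφ⟩ := hf
  rw [totalDeriv_of_representative hΩ hφ hfφ hz]
  exact hasDerivAt_of_representative (v := fun k => Z x (k + 1)) hΩ hφ hfφ (hasDerivAt_id x) hZ hz

/-- The curve of jets through `z` at `x` whose velocity is the shifted jet. -/
def shiftCurve (x : ℝ) (z : Jet ι) (s : ℝ) : Jet ι := fun k => z k + (s - x) • z (k + 1)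

theorem shiftCurve_self (x : ℝ) (z : Jet ι) : shiftCurve x z x = z := by
  funext k
  simp [shiftCurve]

theorem hasDerivAt_shiftCurve (x : ℝ) (z : Jet ι) (k : ℕ) :
    HasDerivAt (fun s => shiftCurve x z s k) (z (k + 1)) x := by
  have h := (((hasDerivAt_id x).sub_const x).smul_const (z (k + 1))).const_add (z k)
  rwa [one_smul] at h

theorem hasDerivAt_shiftCurve_apply (x : ℝ) (z : Jet ι) (k : ℕ) (i : ι) :
    HasDerivAt (fun s => shiftCurve x z s k i) (z (k + 1) i) x :=
  hasDerivAt_pi.1 (hasDerivAt_shiftCurve x z k) i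

theorem IsDiffFun.hasDerivAt_shiftCurve (hΩ : IsOpen Ω) (hf : IsDiffFun Ω f) {x : ℝ}
    {z : Jet ι} (hz : z 0 ∈ Ω) :
    HasDerivAt (fun s => f s (shiftCurve x z s)) (totalDeriv f x z) x := by
  have h := hf.hasDerivAt_totalDeriv (Z := shiftCurve x z) (x := x) hΩ
    (by simpa only [shiftCurve_self] using HydroBracket.hasDerivAt_shiftCurve x z)
    (by rwa [shiftCurve_self])
  rwa [shiftCurve_self] at h

/-- To compute a total derivative, differentiate along the shift curve. -/
theorem IsDiffFun.totalDeriv_eq (hΩ : IsOpen Ω) (hf : IsDiffFun Ω f) {x : ℝ}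
    {z : Jet ι} (hz : z 0 ∈ Ω) {d : ℝ}
    (h : HasDerivAt (fun s => f s (shiftCurve x z s)) d x) : totalDeriv f x z = d :=
  (hf.hasDerivAt_shiftCurve hΩ hz).unique h

theorem IsDiffFun.totalDeriv (hΩ : IsOpen Ω) (hf : IsDiffFun Ω f) :
    IsDiffFun Ω (totalDeriv f) := by
  obtain ⟨n, φ, hφ, hfφ⟩ := hf
  refine ⟨n + 1, fun p => fderiv ℝ φ (p.1, fun j => p.2 j.castSucc) (1, fun j => p.2 j.succ),
    ?_, fun x z hz => ?_⟩
  · refine ContDiffOn.clm_apply ?_ (ContDiff.contDiffOn (by fun_prop))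
    refine (hφ.fderiv_of_isOpen (m := ∞) (isOpen_truncatedJets hΩ n) (by simp)).comp
      (f := fun p : ℝ × (Fin (n + 2) → ι → ℝ) => (p.1, fun j : Fin (n + 1) => p.2 j.castSucc))
      (ContDiff.contDiffOn (by fun_prop)) fun p hp => hp
  · rw [totalDeriv_of_representative hΩ hφ hfφ hz]
    simp

theorem IsDiffFun.jetDeriv (hΩ : IsOpen Ω) (hf : IsDiffFun Ω f) (k : ℕ) (i : ι) :
    IsDiffFun Ω (jetDeriv k i f) := by
  obtain ⟨n, φ, hφ, hfφ⟩ := hf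
  refine ⟨n, fun p => fderiv ℝ φ p (0, fun j => (Pi.single k (Pi.single i 1) : Jet ι) j),
    ?_, fun x z hz => jetDeriv_of_representative hΩ hφ hfφ k i hz⟩
  exact (hφ.fderiv_of_isOpen (m := ∞) (isOpen_truncatedJets hΩ n) (by simp)).clm_apply
    contDiffOn_const

theorem IsDiffFun.exists_jetDeriv_eq_zero (hΩ : IsOpen Ω) (hf : IsDiffFun Ω f) :
    ∃ n : ℕ, ∀ k, n < k → ∀ i x z, z 0 ∈ Ω → HydroBracket.jetDeriv k i f x z = 0 := by
  obtain ⟨n, φ, hφ, hfφ⟩ := hf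
  exact ⟨n, fun k hk i x z hz => jetDeriv_eq_zero_of_representative hΩ hφ hfφ hk i hz⟩

/-- Densities have arbitrary values outside `Ω`. These do not matter: a short segment in a jet
direction keeps the field values in the open set `Ω`. Total and functional derivatives inherit this
locality. -/
theorem jetDeriv_congr (hΩ : IsOpen Ω) (h : ∀ x z, z 0 ∈ Ω → f x z = g x z) (k : ℕ) (i : ι)
    {x : ℝ} {z : Jet ι} (hz : z 0 ∈ Ω) : jetDeriv k i f x z = jetDeriv k i g x z := by
  refine Filter.EventuallyEq.deriv_eq ?_
  have hc : ContinuousAt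
      (fun t : ℝ => (z + t • (Pi.single k (Pi.single i 1) : Jet ι)) 0) 0 := by
    simp only [Pi.add_apply, Pi.smul_apply]
    fun_prop
  filter_upwards [hc.eventually (hΩ.mem_nhds (by simpa using hz))] with t ht using h x _ ht

theorem totalDeriv_congr (hΩ : IsOpen Ω) (h : ∀ x z, z 0 ∈ Ω → f x z = g x z)
    {x : ℝ} {z : Jet ι} (hz : z 0 ∈ Ω) : totalDeriv f x z = totalDeriv g x z := by
  have h1 : (fun s => f s z) = fun s => g s z := funext fun s => h s z hz
  simp only [HydroBracket.totalDeriv, h1, jetDeriv_congr hΩ h _ _ hz]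

theorem iterate_totalDeriv_congr (hΩ : IsOpen Ω) (h : ∀ x z, z 0 ∈ Ω → f x z = g x z) (n : ℕ)
    {x : ℝ} {z : Jet ι} (hz : z 0 ∈ Ω) :
    (totalDeriv^[n] f) x z = (totalDeriv^[n] g) x z := by
  induction n generalizing x z with
  | zero => exact h x z hz
  | succ n ih =>
    simp only [Function.iterate_succ', Function.comp]
    exact totalDeriv_congr hΩ (fun x z hz => ih hz) hz

theorem varDeriv_congr (hΩ : IsOpen Ω) (h : ∀ x z, z 0 ∈ Ω → f x z = g x z) (i : ι)
    {x : ℝ} {z : Jet ι} (hz : z 0 ∈ Ω) : varDeriv i f x z = varDeriv i g x z := by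
  refine finsum_congr fun n => ?_
  rw [iterate_totalDeriv_congr hΩ (fun x z hz => jetDeriv_congr hΩ h n i hz) n hz]

theorem totalDeriv_zero_fun : totalDeriv (fun _ _ => 0 : Density ι) = fun _ _ => 0 := by
  funext x z
  simp [HydroBracket.totalDeriv, HydroBracket.jetDeriv, lineDeriv]

theorem totalDeriv_eq_zero (hΩ : IsOpen Ω) (h : ∀ x z, z 0 ∈ Ω → f x z = 0)
    {x : ℝ} {z : Jet ι} (hz : z 0 ∈ Ω) : totalDeriv f x z = 0 := by
  rw [totalDeriv_congr (g := fun _ _ => 0) hΩ h hz, totalDeriv_zero_fun]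

theorem iterate_totalDeriv_eq_zero (hΩ : IsOpen Ω) (h : ∀ x z, z 0 ∈ Ω → f x z = 0) (n : ℕ)
    {x : ℝ} {z : Jet ι} (hz : z 0 ∈ Ω) : (totalDeriv^[n] f) x z = 0 := by
  rw [iterate_totalDeriv_congr (g := fun _ _ => 0) hΩ h n hz,
    Function.iterate_fixed totalDeriv_zero_fun]

theorem varDeriv_eq_sum (hΩ : IsOpen Ω) {n : ℕ} {i : ι}
    (h : ∀ k, n ≤ k → ∀ x z, z 0 ∈ Ω → jetDeriv k i f x z = 0)
    {x : ℝ} {z : Jet ι} (hz : z 0 ∈ Ω) :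
    varDeriv i f x z =
      ∑ k ∈ Finset.range n, (-1 : ℝ) ^ k * (totalDeriv^[k] (jetDeriv k i f)) x z := by
  refine finsum_eq_sum_of_support_subset _ fun k hk => ?_
  by_contra hkn
  refine hk ?_
  simp only
  rw [iterate_totalDeriv_eq_zero hΩ (h k (by simpa using hkn)) k hz, mul_zero]

theorem IsDiffFun.iterate_totalDeriv (hΩ : IsOpen Ω) (hf : IsDiffFun Ω f) (n : ℕ) :
    IsDiffFun Ω (HydroBracket.totalDeriv^[n] f) := by
  induction n with
  | zero => exact hf
  | succ n ih =>
    rw [Function.iterate_succ']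
    exact ih.totalDeriv hΩ

theorem IsDiffFun.varDeriv (hΩ : IsOpen Ω) (hf : IsDiffFun Ω f) (i : ι) :
    IsDiffFun Ω (varDeriv i f) := by
  obtain ⟨n, hn⟩ := hf.exists_jetDeriv_eq_zero hΩ
  refine IsDiffFun.congr (IsDiffFun.sum (s := Finset.range (n + 1)) fun k _ =>
    (IsDiffFun.const ((-1 : ℝ) ^ k)).mul ((hf.jetDeriv hΩ k i).iterate_totalDeriv hΩ k))
    fun x z hz => varDeriv_eq_sum hΩ (fun k hk => hn k (by omega) i) hz

theorem totalDeriv_mul (hΩ : IsOpen Ω) (hf : IsDiffFun Ω f) (hg : IsDiffFun Ω g)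
    {x : ℝ} {z : Jet ι} (hz : z 0 ∈ Ω) :
    totalDeriv (fun x z => f x z * g x z) x z =
      totalDeriv f x z * g x z + f x z * totalDeriv g x z := by
  refine (hf.mul hg).totalDeriv_eq hΩ hz ?_
  have := (hf.hasDerivAt_shiftCurve (x := x) hΩ hz).mul (hg.hasDerivAt_shiftCurve (x := x) hΩ hz)
  rw [shiftCurve_self] at this
  exact this

theorem totalDeriv_sub (hΩ : IsOpen Ω) (hf : IsDiffFun Ω f) (hg : IsDiffFun Ω g)
    {x : ℝ} {z : Jet ι} (hz : z 0 ∈ Ω) :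
    totalDeriv (fun x z => f x z - g x z) x z = totalDeriv f x z - totalDeriv g x z :=
  (hf.sub hg).totalDeriv_eq hΩ hz
    ((hf.hasDerivAt_shiftCurve (x := x) hΩ hz).sub (hg.hasDerivAt_shiftCurve (x := x) hΩ hz))

theorem totalDeriv_neg (hΩ : IsOpen Ω) (hf : IsDiffFun Ω f)
    {x : ℝ} {z : Jet ι} (hz : z 0 ∈ Ω) :
    totalDeriv (fun x z => -f x z) x z = -totalDeriv f x z :=
  hf.neg.totalDeriv_eq hΩ hz (hf.hasDerivAt_shiftCurve (x := x) hΩ hz).neg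

/-! ### Functional derivatives of densities of order zero and one -/

/-- The functional derivative of a density of order zero is a partial derivative. -/
theorem varDeriv_zeroth (hΩ : IsOpen Ω) {φ : ℝ × (ι → ℝ) → ℝ}
    (i : ι) {x : ℝ} {z : Jet ι} (hz : z 0 ∈ Ω) {d : ℝ}
    (h : HasDerivAt (fun t : ℝ => φ (x, z 0 + t • Pi.single i 1)) d 0) :
    varDeriv i (fun x z => φ (x, z 0)) x z = d := by
  rw [varDeriv_eq_sum (n := 1) hΩ ?_ hz]
  · simpa [HydroBracket.jetDeriv, lineDeriv] using h.deriv
  · intro k hk x z _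
    have : (Pi.single k (Pi.single i 1) : Jet ι) 0 = 0 := Pi.single_eq_of_ne (by omega) _
    simp [HydroBracket.jetDeriv, lineDeriv, this]

/-- The functional derivative of a density of order one. -/
theorem varDeriv_first (hΩ : IsOpen Ω) {φ : ℝ → (ι → ℝ) → (ι → ℝ) → ℝ}
    (i : ι) {x : ℝ} {z : Jet ι} (hz : z 0 ∈ Ω) :
    varDeriv i (fun x z => φ x (z 0) (z 1)) x z =
      deriv (fun t : ℝ => φ x (z 0 + t • Pi.single i 1) (z 1)) 0 -
        totalDeriv (fun x z => deriv (fun t : ℝ => φ x (z 0) (z 1 + t • Pi.single i 1)) 0) x z := by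
  rw [varDeriv_eq_sum (n := 2) hΩ ?_ hz]
  · have h10 : (Pi.single 1 (Pi.single i 1) : Jet ι) 0 = 0 := Pi.single_eq_of_ne (by omega) _
    have h01 : (Pi.single 0 (Pi.single i 1) : Jet ι) 1 = 0 := Pi.single_eq_of_ne (by omega) _
    have e1 : HydroBracket.jetDeriv 1 i (fun x z => φ x (z 0) (z 1)) =
        fun x z => deriv (fun t : ℝ => φ x (z 0) (z 1 + t • Pi.single i 1)) 0 := by
      funext x z
      simp [HydroBracket.jetDeriv, lineDeriv]
    have e0 : HydroBracket.jetDeriv 0 i (fun x z => φ x (z 0) (z 1)) x z =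
        deriv (fun t : ℝ => φ x (z 0 + t • Pi.single i 1) (z 1)) 0 := by
      simp [HydroBracket.jetDeriv, lineDeriv]
    simp only [Finset.sum_range_succ, Finset.sum_range_zero, Function.iterate_zero, id,
      Function.iterate_one, e0, e1]
    ring
  · intro k hk x z _
    have h0 : (Pi.single k (Pi.single i 1) : Jet ι) 0 = 0 := Pi.single_eq_of_ne (by omega) _
    have h1 : (Pi.single k (Pi.single i 1) : Jet ι) 1 = 0 := Pi.single_eq_of_ne (by omega) _
    simp [HydroBracket.jetDeriv, lineDeriv, h0, h1]

end Calculus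


/-! ### Functionals that vanish -/

section Curves

set_option linter.unusedSectionVars false

variable {ι : Type} [Fintype ι] [DecidableEq ι] {Ω : Set (ι → ℝ)} {f g : Density ι}

/-- The jet of a curve of fields. -/
noncomputable def curveJet (c : ℝ → ι → ℝ) (x : ℝ) : Jet ι :=
  fun n i => iteratedDeriv n (fun s => c s i) x

theorem hasDerivAt_curveJet {c : ℝ → ι → ℝ} (hc : ∀ i, ContDiff ℝ ∞ (fun s => c s i)) (x : ℝ)
    (n : ℕ) : HasDerivAt (fun s => curveJet c s n) (curveJet c x (n + 1)) x := by
  refine hasDerivAt_pi.2 fun i => ?_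
  have h := ((hc i).differentiable_iteratedDeriv n
    (by exact_mod_cast WithTop.coe_lt_top n) x).hasDerivAt
  rwa [← iteratedDeriv_succ] at h

theorem curveJet_congr {c c' : ℝ → ι → ℝ} {x : ℝ} (h : c =ᶠ[nhds x] c') :
    curveJet c x = curveJet c' x := by
  funext n i
  refine Filter.EventuallyEq.iteratedDeriv_eq n ?_
  filter_upwards [h] with s hs
  rw [hs]

theorem curveJet_zero (c : ℝ → ι → ℝ) (x : ℝ) : curveJet c x 0 = c x := by
  funext i
  simp [curveJet]

theorem IntegralZero.neg (hΩ : IsOpen Ω) (hf : IntegralZero Ω f) :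
    IntegralZero Ω (fun x z => -f x z) := by
  obtain ⟨h, hh, e⟩ := hf
  exact ⟨_, hh.neg, fun x z hz => by simp only [totalDeriv_neg hΩ hh hz, e x z hz]⟩

theorem IntegralZero.sub_totalDeriv (hΩ : IsOpen Ω) (hf : IntegralZero Ω f)
    (hg : IsDiffFun Ω g) : IntegralZero Ω (fun x z => f x z - totalDeriv g x z) := by
  obtain ⟨h, hh, e⟩ := hf
  exact ⟨_, hh.sub hg, fun x z hz => by simp only [totalDeriv_sub hΩ hh hg hz, e x z hz]⟩

end Curves

section Fields

variable {m : ℕ} {W : Set (Fin m → ℝ)}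

theorem isOpen_fieldDomain (hW : IsOpen W) : IsOpen (fieldDomain W) :=
  (isOpen_lt (f := fun _ : Fin 2 ⊕ Fin m → ℝ => (0 : ℝ)) (g := fun v => v iρ) (by fun_prop)
    (by fun_prop)).inter
    (hW.preimage (f := fun (v : Fin 2 ⊕ Fin m → ℝ) k => v (iw k)) (by fun_prop))

/-- The affine curve of fields through `w` with velocity `v`, of mass density `1 + φ`. -/
def affineCurve (φ : ℝ → ℝ) (x₀ : ℝ) (w v : Fin m → ℝ) (s : ℝ) : Fin 2 ⊕ Fin m → ℝ :=
  Sum.elim ![1 + φ s, 0] fun k => w k + (s - x₀) * v k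

theorem contDiff_affineCurve {φ : ℝ → ℝ} (hφ : ContDiff ℝ ∞ φ) (x₀ : ℝ) (w v : Fin m → ℝ)
    (i : Fin 2 ⊕ Fin m) : ContDiff ℝ ∞ (fun s => affineCurve φ x₀ w v s i) := by
  rcases i with i | k
  · fin_cases i
    · simpa [affineCurve] using contDiff_const.add hφ
    · simpa [affineCurve] using contDiff_const
  · simp only [affineCurve, Sum.elim_inr]
    fun_prop

theorem curveJet_affineCurve_one (φ : ℝ → ℝ) (x₀ : ℝ) (w v : Fin m → ℝ) (s : ℝ) (k : Fin m) :
    curveJet (affineCurve φ x₀ w v) s 1 (iw k) = v k := by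
  simp [curveJet, affineCurve, iteratedDeriv_one]

/-- Let `h` be a primitive of `D`, and compare it along two field curves with the same affine `w`:
one with `ρ = 1`, one with `ρ = 1 + φ` for a bump `φ` at `x₀`. If `T` were positive near `x₀`, the
difference of the two values of `h` would be nondecreasing. It vanishes on both sides of the bump,
where the curves agree, so it vanishes in between too. But its derivative at `x₀` is `(ψ 2 - ψ 1) T
> 0`. -/
theorem not_pos_of_integralZero (hW : IsOpen W) {D : Density (Fin 2 ⊕ Fin m)}
    (hD : IntegralZero (fieldDomain W) D) {ψ : ℝ → ℝ} (hψ : StrictMonoOn ψ (Set.Ioi 0))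
    (hψ1 : ψ 1 ≠ 0) {T : ℝ → (Fin m → ℝ) → (Fin m → ℝ) → ℝ}
    (hT : ∀ x z, z 0 ∈ fieldDomain W →
      D x z = ψ (z 0 iρ) * T x (wval z) (fun k => z 1 (iw k)))
    (x₀ : ℝ) {w : Fin m → ℝ} (hw : w ∈ W) (v : Fin m → ℝ) : ¬ 0 < T x₀ w v := by
  intro hpos
  have hΩ := isOpen_fieldDomain hW
  obtain ⟨h, hh, hDh⟩ := hD
  set q : ℝ → ℝ := fun s => T s (fun k => w k + (s - x₀) * v k) v with hq
  have hq0 : q x₀ = T x₀ w v := by simp [hq]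
  have hWev : ∀ᶠ s in nhds x₀, (fun k => w k + (s - x₀) * v k) ∈ W := by
    have : ContinuousAt (fun s => (fun k => w k + (s - x₀) * v k)) x₀ := by fun_prop
    exact this.eventually (hW.mem_nhds (by simpa using hw))
  have hmem : ∀ (φ : ℝ → ℝ) (s : ℝ), 0 ≤ φ s → (fun k => w k + (s - x₀) * v k) ∈ W →
      curveJet (affineCurve φ x₀ w v) s 0 ∈ fieldDomain W := by
    intro φ s hφs hs
    rw [curveJet_zero]
    refine ⟨?_, hs⟩
    simp only [affineCurve, Sum.elim_inl, Matrix.cons_val_zero]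
    linarith
  have hval : ∀ (φ : ℝ → ℝ) (s : ℝ), 0 ≤ φ s → (fun k => w k + (s - x₀) * v k) ∈ W →
      totalDeriv h s (curveJet (affineCurve φ x₀ w v) s) = ψ (1 + φ s) * q s := by
    intro φ s hφs hs
    rw [← hDh _ _ (hmem φ s hφs hs), hT _ _ (hmem φ s hφs hs)]
    simp only [curveJet_affineCurve_one, curveJet_zero]
    rfl
  -- No regularity of `T` is assumed. Continuity of `q` is read off from the total derivative of `h`
  -- along the curve with `ρ = 1`; this is where `ψ 1 ≠ 0` enters.
  have hqc : ContinuousAt q x₀ := by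
    have h1 : ContinuousAt (fun s => totalDeriv h s
        (curveJet (affineCurve (fun _ => 0) x₀ w v) s) / ψ 1) x₀ :=
      ((hh.totalDeriv hΩ).hasDerivAt_totalDeriv hΩ
        (hasDerivAt_curveJet (contDiff_affineCurve contDiff_const x₀ w v) x₀)
        (hmem _ _ le_rfl (by simpa using hw))).continuousAt.div_const _
    refine h1.congr ?_
    filter_upwards [hWev] with s hs
    rw [hval _ s le_rfl hs, add_zero, mul_div_cancel_left₀ _ hψ1]
  obtain ⟨ε, hε, hball⟩ := Metric.eventually_nhds_iff_ball.1
    (hWev.and (hqc.eventually (lt_mem_nhds (hq0 ▸ hpos))))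
  let φ : ContDiffBump x₀ := ⟨ε / 4, ε / 2, by positivity, by linarith⟩
  have hφ : ContDiff ℝ ∞ φ := φ.contDiff
  set H : ℝ → ℝ := fun s => h s (curveJet (affineCurve φ x₀ w v) s) -
    h s (curveJet (affineCurve (fun _ => 0) x₀ w v) s) with hH
  -- The radius `3ε/4` lies between the outer radius `ε/2` of the bump and the radius `ε` of the
  -- ball where `q` is positive.
  have hIcc : ∀ s ∈ Set.Icc (x₀ - 3 / 4 * ε) (x₀ + 3 / 4 * ε), s ∈ Metric.ball x₀ ε := by
    intro s hs
    rw [Metric.mem_ball, Real.dist_eq, abs_lt]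
    constructor <;> linarith [hs.1, hs.2]
  have hHd : ∀ s ∈ Set.Icc (x₀ - 3 / 4 * ε) (x₀ + 3 / 4 * ε),
      HasDerivAt H ((ψ (1 + φ s) - ψ 1) * q s) s := by
    intro s hs
    have hsW := (hball s (hIcc s hs)).1
    have h1 := hh.hasDerivAt_totalDeriv hΩ
      (hasDerivAt_curveJet (contDiff_affineCurve hφ x₀ w v) s) (hmem _ s φ.nonneg hsW)
    have h2 := hh.hasDerivAt_totalDeriv hΩ
      (hasDerivAt_curveJet (contDiff_affineCurve contDiff_const x₀ w v) s) (hmem _ s le_rfl hsW)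
    rw [hval _ s φ.nonneg hsW] at h1
    rw [hval _ s le_rfl hsW, add_zero] at h2
    exact (h1.sub h2).congr_deriv (by ring)
  have hmono : MonotoneOn H (Set.Icc (x₀ - 3 / 4 * ε) (x₀ + 3 / 4 * ε)) := by
    refine monotoneOn_of_deriv_nonneg (convex_Icc _ _)
      (fun s hs => (hHd s hs).continuousAt.continuousWithinAt)
      (fun s hs => (hHd s (interior_subset hs)).differentiableAt.differentiableWithinAt)
      fun s hs => ?_
    have hs' := interior_subset hs
    rw [(hHd s hs').deriv]
    refine mul_nonneg (sub_nonneg.2 (hψ.monotoneOn (by simp) ?_ ?_)) (hball s (hIcc s hs')).2.le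
    · exact show (0 : ℝ) < 1 + φ s by linarith [φ.nonneg (x := s)]
    · linarith [φ.nonneg (x := s)]
  have hends : ∀ s, ε / 2 < dist s x₀ → H s = 0 := by
    intro s hs
    have hev : affineCurve φ x₀ w v =ᶠ[nhds s] affineCurve (fun _ => 0) x₀ w v := by
      have hc : ContinuousAt (fun s => dist s x₀) s := by fun_prop
      filter_upwards [hc.eventually (lt_mem_nhds hs)] with s' hs'
      simp only [affineCurve, φ.zero_of_le_dist hs'.le]
    simp [hH, curveJet_congr hev]
  have hH1 : H (x₀ - 3 / 4 * ε) = 0 := by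
    refine hends _ ?_
    rw [Real.dist_eq, sub_sub_cancel_left, abs_neg, abs_of_pos (by positivity)]
    linarith
  have hH2 : H (x₀ + 3 / 4 * ε) = 0 := by
    refine hends _ ?_
    rw [Real.dist_eq, add_sub_cancel_left, abs_of_pos (by positivity)]
    linarith
  have hzero : H =ᶠ[nhds x₀] fun _ => 0 := by
    filter_upwards [Icc_mem_nhds (show x₀ - 3 / 4 * ε < x₀ by linarith)
      (show x₀ < x₀ + 3 / 4 * ε by linarith)] with s hs
    have hle : x₀ - 3 / 4 * ε ≤ x₀ + 3 / 4 * ε := by linarith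
    have g1 := hmono (Set.left_mem_Icc.2 hle) hs hs.1
    have g2 := hmono hs (Set.right_mem_Icc.2 hle) hs.2
    rw [hH1] at g1
    rw [hH2] at g2
    exact le_antisymm g2 g1
  have hd := (hHd x₀ ⟨by linarith, by linarith⟩).unique
    ((hasDerivAt_const x₀ (0 : ℝ)).congr_of_eventuallyEq hzero)
  rw [φ.one_of_mem_closedBall (Metric.mem_closedBall_self φ.rIn_pos.le), hq0] at hd
  have : ψ 1 < ψ (1 + 1) := hψ (by simp) (by norm_num) (by norm_num)
  exact absurd hd (mul_pos (by linarith) hpos).ne'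

/-- A density `ψ(ρ) T(x, w, ∂ₓw)` with `ψ` strictly increasing has zero integral only if `T`
vanishes. -/
theorem eq_zero_of_integralZero (hW : IsOpen W) {D : Density (Fin 2 ⊕ Fin m)}
    (hD : IntegralZero (fieldDomain W) D) {ψ : ℝ → ℝ} (hψ : StrictMonoOn ψ (Set.Ioi 0))
    (hψ1 : ψ 1 ≠ 0) {T : ℝ → (Fin m → ℝ) → (Fin m → ℝ) → ℝ}
    (hT : ∀ x z, z 0 ∈ fieldDomain W →
      D x z = ψ (z 0 iρ) * T x (wval z) (fun k => z 1 (iw k)))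
    (x₀ : ℝ) {w : Fin m → ℝ} (hw : w ∈ W) (v : Fin m → ℝ) : T x₀ w v = 0 := by
  refine le_antisymm (not_lt.1 (not_pos_of_integralZero hW hD hψ hψ1 hT x₀ hw v)) ?_
  have := not_pos_of_integralZero hW (hD.neg (isOpen_fieldDomain hW)) hψ hψ1
    (T := fun x w v => -T x w v) (fun x z hz => by rw [hT x z hz]; ring) x₀ hw v
  linarith

/-! ### Functions of the fields `w` -/

theorem hasDerivAt_update_line {F : (Fin m → ℝ) → ℝ} {w : Fin m → ℝ}
    (hF : DifferentiableAt ℝ F w) (n : Fin m) :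
    HasDerivAt (fun t : ℝ => F (w + t • Pi.single n 1)) (fderiv ℝ F w (Pi.single n 1)) 0 :=
  hF.hasFDerivAt.hasLineDerivAt _

theorem clm_apply_eq_sum (L : (Fin m → ℝ) →L[ℝ] ℝ) (v : Fin m → ℝ) :
    L v = ∑ j, L (Pi.single j 1) * v j := by
  conv_lhs => rw [pi_eq_sum_univ' v]
  simp [mul_comm]

theorem isDiffFun_comp_wval {F : (Fin m → ℝ) → ℝ} (hF : ContDiffOn ℝ ∞ F W) :
    IsDiffFun (fieldDomain W) (fun _ z => F (wval z)) :=
  IsDiffFun.of_zeroth (φ := fun p => F fun k => p.2 (iw k))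
    (hF.comp (ContDiff.contDiffOn (by fun_prop)) fun _ hp => hp.2)

theorem isDiffFun_position {Ω : Set (Fin 2 ⊕ Fin m → ℝ)} {a : ℝ → ℝ} (ha : ContDiff ℝ ∞ a) :
    IsDiffFun Ω (fun x _ => a x) :=
  IsDiffFun.of_zeroth (φ := fun p => a p.1) (ContDiff.contDiffOn (by fun_prop))

theorem totalDeriv_comp_wval (hW : IsOpen W) {F : (Fin m → ℝ) → ℝ} (hF : ContDiffOn ℝ ∞ F W)
    {x : ℝ} {z : Jet (Fin 2 ⊕ Fin m)} (hz : z 0 ∈ fieldDomain W) :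
    totalDeriv (fun _ z => F (wval z)) x z =
      ∑ j, fderiv ℝ F (wval z) (Pi.single j 1) * z 1 (iw j) := by
  rw [← clm_apply_eq_sum (fderiv ℝ F (wval z)) fun j => z 1 (iw j)]
  refine (isDiffFun_comp_wval hF).totalDeriv_eq (isOpen_fieldDomain hW) hz ?_
  have hd : HasFDerivAt F (fderiv ℝ F (wval z)) (wval (shiftCurve x z x)) := by
    rw [shiftCurve_self]
    exact ((hF.contDiffAt (hW.mem_nhds hz.2)).differentiableAt (by simp)).hasFDerivAt
  exact hd.comp_hasDerivAt (f := fun s => wval (shiftCurve x z s)) x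
    (hasDerivAt_pi.2 fun j => hasDerivAt_shiftCurve_apply x z 0 (iw j))

theorem totalDeriv_coord (hW : IsOpen W) {x : ℝ} {z : Jet (Fin 2 ⊕ Fin m)}
    (hz : z 0 ∈ fieldDomain W) (n : ℕ) (i : Fin 2 ⊕ Fin m) :
    totalDeriv (fun _ z => z n i) x z = z (n + 1) i :=
  (IsDiffFun.coord n i).totalDeriv_eq (isOpen_fieldDomain hW) hz
    (hasDerivAt_shiftCurve_apply x z n i)

theorem totalDeriv_position (hW : IsOpen W) {a : ℝ → ℝ} (ha : ContDiff ℝ ∞ a)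
    {x : ℝ} {z : Jet (Fin 2 ⊕ Fin m)} (hz : z 0 ∈ fieldDomain W) :
    totalDeriv (fun x _ => a x) x z = deriv a x :=
  (isDiffFun_position ha).totalDeriv_eq (isOpen_fieldDomain hW) hz
    (ha.differentiable (by simp) x).hasDerivAt

/-! ### Test functionals -/

/-- The density `b(x, ρ) ρ w_k`. -/
def testDensity (b : ℝ × ℝ → ℝ) (k : Fin m) : Density (Fin 2 ⊕ Fin m) :=
  fun x z => b (x, z 0 iρ) * z 0 iρ * z 0 (iw k)

theorem isDiffFun_testDensity {b : ℝ × ℝ → ℝ} (hb : ContDiff ℝ ∞ b) (k : Fin m) :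
    IsDiffFun (fieldDomain W) (testDensity b k) :=
  IsDiffFun.of_zeroth (φ := fun p => b (p.1, p.2 iρ) * p.2 iρ * p.2 (iw k))
    (ContDiff.contDiffOn (by fun_prop))

theorem varDeriv_iu_testDensity (hW : IsOpen W) (b : ℝ × ℝ → ℝ) (k : Fin m) {x : ℝ}
    {z : Jet (Fin 2 ⊕ Fin m)} (hz : z 0 ∈ fieldDomain W) :
    varDeriv iu (testDensity b k) x z = 0 := by
  refine varDeriv_zeroth (φ := fun p => b (p.1, p.2 iρ) * p.2 iρ * p.2 (iw k))
    (isOpen_fieldDomain hW) iu hz ?_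
  simpa using hasDerivAt_const (0 : ℝ) (b (x, z 0 iρ) * z 0 iρ * z 0 (iw k))

/-- The factor `ρ` of the test density cancels the `1/ρ` of the bracket, so the coefficient `b`
alone is left. -/
theorem varDeriv_iw_testDensity (hW : IsOpen W) (b : ℝ × ℝ → ℝ) (k p : Fin m) {x : ℝ}
    {z : Jet (Fin 2 ⊕ Fin m)} (hz : z 0 ∈ fieldDomain W) :
    varDeriv (iw p) (testDensity b k) x z / z 0 iρ = if p = k then b (x, z 0 iρ) else 0 := by
  have h : varDeriv (iw p) (testDensity b k) x z =
      b (x, z 0 iρ) * z 0 iρ * (Pi.single p 1 : Fin m → ℝ) k := by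
    refine varDeriv_zeroth (φ := fun p => b (p.1, p.2 iρ) * p.2 iρ * p.2 (iw k))
      (isOpen_fieldDomain hW) (iw p) hz ?_
    have h1 : HasDerivAt (fun t : ℝ => z 0 (iw k) + t * (Pi.single p 1 : Fin m → ℝ) k)
        ((Pi.single p 1 : Fin m → ℝ) k) 0 := by
      simpa using ((hasDerivAt_id (0 : ℝ)).mul_const ((Pi.single p 1 : Fin m → ℝ) k)).const_add
        (z 0 (iw k))
    have h2 := h1.const_mul (b (x, z 0 iρ) * z 0 iρ)
    simpa [Pi.single_apply] using h2
  have hρ : z 0 iρ ≠ 0 := hz.1.ne'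
  rw [h]
  by_cases hpk : p = k
  · subst hpk
    rw [if_pos rfl, Pi.single_eq_same, mul_one, mul_div_cancel_right₀ _ hρ]
  · rw [if_neg hpk, Pi.single_eq_of_ne (Ne.symm hpk), mul_zero, zero_div]

/-- The bracket of a test functional with a functional that does not involve `u`. -/
theorem decBracket_testDensity (hW : IsOpen W) (α : (Fin m → ℝ) → Matrix (Fin m) (Fin m) ℝ)
    (β : (Fin m → ℝ) → Fin m → Fin m → Fin m → ℝ) (b : ℝ × ℝ → ℝ) (k : Fin m)
    {g : Density (Fin 2 ⊕ Fin m)}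
    (hg : ∀ x z, z 0 ∈ fieldDomain W → varDeriv iu g x z = 0) {x : ℝ}
    {z : Jet (Fin 2 ⊕ Fin m)} (hz : z 0 ∈ fieldDomain W) :
    decBracket α β (testDensity b k) g x z =
      ∑ l, (totalDeriv (fun x z => b (x, z 0 iρ)) x z * α (wval z) k l +
        b (x, z 0 iρ) * ∑ j, β (wval z) k l j * z 1 (iw j)) *
          (varDeriv (iw l) g x z / z 0 iρ) := by
  have hΩ := isOpen_fieldDomain hW
  have h1 : ∀ p, totalDeriv (fun x z => varDeriv (iw p) (testDensity b k) x z / z 0 iρ) x z =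
      if p = k then totalDeriv (fun x z => b (x, z 0 iρ)) x z else 0 := by
    intro p
    rw [totalDeriv_congr hΩ (fun x z hz => varDeriv_iw_testDensity hW b k p hz) hz]
    by_cases hpk : p = k
    · simp only [if_pos hpk]
    · simp only [if_neg hpk, totalDeriv_zero_fun]
  simp only [decBracket, h1, varDeriv_iw_testDensity hW b k _ hz, varDeriv_iu_testDensity hW b k hz,
    hg x z hz, totalDeriv_eq_zero hΩ (fun x z hz => varDeriv_iu_testDensity hW b k hz) hz,
    totalDeriv_eq_zero hΩ hg hz]
  simp only [zero_mul, mul_zero, sub_zero, Finset.sum_const_zero, add_zero, zero_add]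
  rw [Finset.sum_eq_single k]
  · refine Finset.sum_congr rfl fun l _ => ?_
    simp only [if_true]
    ring
  · intro p _ hp
    simp [hp]
  · simp

theorem decBracket_testDensity_testDensity (hW : IsOpen W)
    (α : (Fin m → ℝ) → Matrix (Fin m) (Fin m) ℝ)
    (β : (Fin m → ℝ) → Fin m → Fin m → Fin m → ℝ) (b c : ℝ × ℝ → ℝ) (k l : Fin m) {x : ℝ}
    {z : Jet (Fin 2 ⊕ Fin m)} (hz : z 0 ∈ fieldDomain W) :
    decBracket α β (testDensity b k) (testDensity c l) x z =
      (totalDeriv (fun x z => b (x, z 0 iρ)) x z * α (wval z) k l +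
        b (x, z 0 iρ) * ∑ j, β (wval z) k l j * z 1 (iw j)) * c (x, z 0 iρ) := by
  rw [decBracket_testDensity hW α β b k (fun x z hz => varDeriv_iu_testDensity hW c l hz) hz]
  simp [varDeriv_iw_testDensity hW c l _ hz]

/-! ### Pointwise identities from antisymmetry and the Jacobi identity -/

variable {α : (Fin m → ℝ) → Matrix (Fin m) (Fin m) ℝ}
  {β : (Fin m → ℝ) → Fin m → Fin m → Fin m → ℝ}

/-- Antisymmetry of the bracket makes `α` parallel: `β_klj + β_lkj = ∂_j α_kl`. -/
theorem IsPoisson.beta_add_beta (hW : IsOpen W)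
    (hα : ∀ k l, ContDiffOn ℝ ∞ (fun w => α w k l) W) (hsymm : ∀ w ∈ W, (α w).IsSymm)
    (hP : IsPoisson (fieldDomain W) (decBracket α β)) {w : Fin m → ℝ} (hw : w ∈ W)
    (k l j : Fin m) :
    β w k l j + β w l k j = fderiv ℝ (fun w => α w k l) w (Pi.single j 1) := by
  have hΩ := isOpen_fieldDomain hW
  -- With coefficients `b = ρ` and `c = 1` the symmetrized bracket is `∂ₓρ α_kl + ρ (β_kl + β_lk)`.
  -- Subtracting `∂ₓ(ρ α_kl)` leaves `ρ` times a function of `w` and `∂ₓw`. Coefficients depending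
  -- on `x` only would give no strictly monotone factor in `ρ`.
  have h1 := hP.antisymm _ _ (isDiffFun_testDensity (b := fun p => p.2) (by fun_prop) k)
    (isDiffFun_testDensity (b := fun _ => 1) (by fun_prop) l)
  have hd : IsDiffFun (fieldDomain W)
      (fun (_ : ℝ) (z : Jet (Fin 2 ⊕ Fin m)) => z 0 iρ * α (wval z) k l) :=
    (IsDiffFun.coord 0 iρ).mul (isDiffFun_comp_wval (hα k l))
  have h2 := h1.sub_totalDeriv hΩ hd
  have h3 := eq_zero_of_integralZero hW h2 (ψ := fun r => r) (fun _ _ _ _ h => h) one_ne_zero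
    (T := fun _ w v => ∑ j, (β w k l j + β w l k j
      - fderiv ℝ (fun w => α w k l) w (Pi.single j 1)) * v j) ?_ 0 hw (Pi.single j 1)
  · simp only [Pi.single_apply, mul_ite, mul_one, mul_zero, Finset.sum_ite_eq',
      Finset.mem_univ, if_true] at h3
    linarith
  · intro x z hz
    have e2 : totalDeriv (fun _ _ => 1 : Density (Fin 2 ⊕ Fin m)) x z = 0 :=
      (totalDeriv_position hW contDiff_const hz).trans (by simp)
    have e3 : α (wval z) l k = α (wval z) k l := (hsymm _ hz.2).apply k l
    rw [decBracket_testDensity_testDensity hW α β _ _ k l hz,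
      decBracket_testDensity_testDensity hW α β _ _ l k hz,
      totalDeriv_mul hΩ (IsDiffFun.coord 0 iρ) (isDiffFun_comp_wval (hα k l)) hz,
      totalDeriv_coord hW hz, totalDeriv_comp_wval hW (hα k l) hz, e2, e3]
    simp only [zero_add, sub_mul, add_mul, Finset.sum_sub_distrib, Finset.sum_add_distrib]
    ring

/-- The bracket of two test functionals with coefficients depending on the position. -/
noncomputable def testBracket (α : (Fin m → ℝ) → Matrix (Fin m) (Fin m) ℝ)
    (β : (Fin m → ℝ) → Fin m → Fin m → Fin m → ℝ) (b c : ℝ → ℝ) (k l : Fin m) :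
    Density (Fin 2 ⊕ Fin m) :=
  fun x z => deriv b x * c x * α (wval z) k l +
    b x * c x * ∑ j, β (wval z) k l j * z 1 (iw j)

theorem decBracket_eq_testBracket (hW : IsOpen W) {b c : ℝ → ℝ} (hb : ContDiff ℝ ∞ b)
    (k l : Fin m) {x : ℝ} {z : Jet (Fin 2 ⊕ Fin m)} (hz : z 0 ∈ fieldDomain W) :
    decBracket α β (testDensity (fun p => b p.1) k) (testDensity (fun p => c p.1) l) x z =
      testBracket α β b c k l x z := by
  rw [decBracket_testDensity_testDensity hW α β _ _ k l hz, totalDeriv_position hW hb hz]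
  simp only [testBracket]
  ring

theorem varDeriv_iu_testBracket (hW : IsOpen W) (b c : ℝ → ℝ) (k l : Fin m) {x : ℝ}
    {z : Jet (Fin 2 ⊕ Fin m)} (hz : z 0 ∈ fieldDomain W) :
    varDeriv iu (testBracket α β b c k l) x z = 0 := by
  have h := varDeriv_first (φ := fun x z0 z1 => deriv b x * c x * α (fun p => z0 (iw p)) k l +
    b x * c x * ∑ j, β (fun p => z0 (iw p)) k l j * z1 (iw j)) (isOpen_fieldDomain hW) iu
    (x := x) hz
  refine Eq.trans h ?_
  simp [totalDeriv_zero_fun]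

theorem varDeriv_iw_testBracket (hW : IsOpen W)
    (hα : ∀ k l, ContDiffOn ℝ ∞ (fun w => α w k l) W)
    (hβ : ∀ k l j, ContDiffOn ℝ ∞ (fun w => β w k l j) W) {b c : ℝ → ℝ}
    (hb : ContDiff ℝ ∞ b) (hc : ContDiff ℝ ∞ c) (k l n : Fin m) {x : ℝ}
    {z : Jet (Fin 2 ⊕ Fin m)} (hz : z 0 ∈ fieldDomain W) :
    varDeriv (iw n) (testBracket α β b c k l) x z =
      deriv b x * c x * fderiv ℝ (fun w => α w k l) (wval z) (Pi.single n 1) +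
      b x * c x * ∑ j, fderiv ℝ (fun w => β w k l j) (wval z) (Pi.single n 1) * z 1 (iw j) -
      ((deriv b x * c x + b x * deriv c x) * β (wval z) k l n + b x * c x *
        ∑ j, fderiv ℝ (fun w => β w k l n) (wval z) (Pi.single j 1) * z 1 (iw j)) := by
  have hΩ := isOpen_fieldDomain hW
  have h := varDeriv_first (φ := fun x z0 z1 => deriv b x * c x * α (fun p => z0 (iw p)) k l +
    b x * c x * ∑ j, β (fun p => z0 (iw p)) k l j * z1 (iw j)) hΩ (iw n) (x := x) hz
  refine Eq.trans h ?_
  have hline : ∀ t : ℝ, (fun p : Fin m => (z 0 + t • Pi.single (iw n) 1 : Fin 2 ⊕ Fin m → ℝ) (iw p)) =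
      wval z + t • Pi.single n 1 := by
    intro t
    funext p
    simp [wval, Pi.single_apply]
  have hw := hW.mem_nhds hz.2
  have d1 : deriv (fun t : ℝ => deriv b x * c x *
      α (fun p => (z 0 + t • Pi.single (iw n) 1 : Fin 2 ⊕ Fin m → ℝ) (iw p)) k l +
      b x * c x * ∑ j, β (fun p => (z 0 + t • Pi.single (iw n) 1 : Fin 2 ⊕ Fin m → ℝ) (iw p)) k l j * z 1 (iw j)) 0 =
      deriv b x * c x * fderiv ℝ (fun w => α w k l) (wval z) (Pi.single n 1) +
      b x * c x * ∑ j, fderiv ℝ (fun w => β w k l j) (wval z) (Pi.single n 1) * z 1 (iw j) := by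
    simp only [hline]
    refine HasDerivAt.deriv (HasDerivAt.add (HasDerivAt.const_mul _ ?_)
      (HasDerivAt.const_mul _ (HasDerivAt.fun_sum fun j _ => HasDerivAt.mul_const ?_ _)))
    · exact hasDerivAt_update_line (((hα k l).contDiffAt hw).differentiableAt (by simp)) n
    · exact hasDerivAt_update_line (((hβ k l j).contDiffAt hw).differentiableAt (by simp)) n
  have d2 : (fun x (z : Jet (Fin 2 ⊕ Fin m)) => deriv (fun t : ℝ => deriv b x * c x *
      α (fun p => z 0 (iw p)) k l + b x * c x * ∑ j, β (fun p => z 0 (iw p)) k l j *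
        (z 1 + t • Pi.single (iw n) 1 : Fin 2 ⊕ Fin m → ℝ) (iw j)) 0) =
      fun x z => b x * c x * β (wval z) k l n := by
    funext x z
    refine HasDerivAt.deriv ?_
    have h1 : ∀ j, HasDerivAt (fun t : ℝ =>
        (z 1 + t • Pi.single (iw n) 1 : Fin 2 ⊕ Fin m → ℝ) (iw j))
        ((Pi.single n 1 : Fin m → ℝ) j) 0 := by
      intro j
      have := ((hasDerivAt_id (0 : ℝ)).mul_const ((Pi.single n 1 : Fin m → ℝ) j)).const_add
        (z 1 (iw j))
      simpa [Pi.single_apply] using this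
    have h2 := ((HasDerivAt.fun_sum (u := Finset.univ) fun j _ => (h1 j).const_mul
      (β (fun p => z 0 (iw p)) k l j)).const_mul (b x * c x)).const_add
        (deriv b x * c x * α (fun p => z 0 (iw p)) k l)
    refine h2.congr_deriv ?_
    have hw : (fun p => z 0 (iw p)) = wval z := rfl
    simp [Pi.single_apply, hw]
  have hbc : ContDiff ℝ ∞ (fun x => b x * c x) := hb.mul hc
  rw [d1, d2, totalDeriv_mul hΩ (f := fun x _ => b x * c x) (isDiffFun_position hbc)
    (isDiffFun_comp_wval (hβ k l n)) hz, totalDeriv_position hW hbc hz,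
    totalDeriv_comp_wval hW (hβ k l n) hz]
  rw [deriv_fun_mul (hb.differentiable (by simp) x) (hc.differentiable (by simp) x)]

/-- The contribution of `{F, {G, H}}` to the Jacobi identity for test functionals with coefficients
`a`, `b`, `c` and fields `i`, `k`, `l`. -/
noncomputable def jacobiTerm (α : (Fin m → ℝ) → Matrix (Fin m) (Fin m) ℝ)
    (β : (Fin m → ℝ) → Fin m → Fin m → Fin m → ℝ) (a a' b b' c c' : ℝ) (i k l : Fin m)
    (w v : Fin m → ℝ) : ℝ :=
  ∑ n, (a' * α w i n + a * ∑ j, β w i n j * v j) *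
    (b' * c * fderiv ℝ (fun w => α w k l) w (Pi.single n 1) +
      b * c * ∑ j, fderiv ℝ (fun w => β w k l j) w (Pi.single n 1) * v j -
      ((b' * c + b * c') * β w k l n +
        b * c * ∑ j, fderiv ℝ (fun w => β w k l n) w (Pi.single j 1) * v j))

/-- The inner bracket involves neither `u` nor `ρ`. Hence the only dependence on `ρ` is the factor
`1/ρ` that the outer bracket puts on the `w`-derivatives of its second argument. -/
theorem decBracket_testDensity_decBracket (hW : IsOpen W)
    (hα : ∀ k l, ContDiffOn ℝ ∞ (fun w => α w k l) W)
    (hβ : ∀ k l j, ContDiffOn ℝ ∞ (fun w => β w k l j) W) {a b c : ℝ → ℝ}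
    (ha : ContDiff ℝ ∞ a) (hb : ContDiff ℝ ∞ b) (hc : ContDiff ℝ ∞ c) (i k l : Fin m) {x : ℝ}
    {z : Jet (Fin 2 ⊕ Fin m)} (hz : z 0 ∈ fieldDomain W) :
    decBracket α β (testDensity (fun p => a p.1) i) (decBracket α β
      (testDensity (fun p => b p.1) k) (testDensity (fun p => c p.1) l)) x z =
      (z 0 iρ)⁻¹ * jacobiTerm α β (a x) (deriv a x) (b x) (deriv b x) (c x) (deriv c x) i k l
        (wval z) (fun j => z 1 (iw j)) := by
  have hΩ := isOpen_fieldDomain hW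
  have hcongr : ∀ (p : Fin 2 ⊕ Fin m) (x : ℝ) (z : Jet (Fin 2 ⊕ Fin m)), z 0 ∈ fieldDomain W →
      varDeriv p (decBracket α β (testDensity (fun p => b p.1) k)
        (testDensity (fun p => c p.1) l)) x z = varDeriv p (testBracket α β b c k l) x z :=
    fun p x z hz => varDeriv_congr hΩ (fun x z hz => decBracket_eq_testBracket hW hb k l hz) p hz
  rw [decBracket_testDensity hW α β _ i (fun x z hz => by
    rw [hcongr iu x z hz, varDeriv_iu_testBracket hW b c k l hz]) hz, totalDeriv_position hW ha hz,
    jacobiTerm, Finset.mul_sum]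
  refine Finset.sum_congr rfl fun n _ => ?_
  rw [hcongr _ x z hz, varDeriv_iw_testBracket hW hα hβ hb hc k l n hz]
  ring

/-- The Jacobi densities carry the decreasing factor `1/ρ`. The sign, compensated in `T`, makes it
increasing, as `eq_zero_of_integralZero` requires. -/
theorem strictMonoOn_neg_inv : StrictMonoOn (fun r : ℝ => -r⁻¹) (Set.Ioi 0) :=
  fun _ hr _ _ h => neg_lt_neg (inv_strictAnti₀ hr h)

/-- The pointwise content of the Jacobi identity for test functionals. -/
theorem IsPoisson.jacobiTerm_add (hW : IsOpen W)
    (hα : ∀ k l, ContDiffOn ℝ ∞ (fun w => α w k l) W)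
    (hβ : ∀ k l j, ContDiffOn ℝ ∞ (fun w => β w k l j) W)
    (hP : IsPoisson (fieldDomain W) (decBracket α β)) {w : Fin m → ℝ} (hw : w ∈ W)
    {a b c : ℝ → ℝ} (ha : ContDiff ℝ ∞ a) (hb : ContDiff ℝ ∞ b) (hc : ContDiff ℝ ∞ c)
    (i k l : Fin m) (x : ℝ) (v : Fin m → ℝ) :
    jacobiTerm α β (a x) (deriv a x) (b x) (deriv b x) (c x) (deriv c x) i k l w v +
    jacobiTerm α β (b x) (deriv b x) (c x) (deriv c x) (a x) (deriv a x) k l i w v +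
    jacobiTerm α β (c x) (deriv c x) (a x) (deriv a x) (b x) (deriv b x) l i k w v = 0 := by
  have h1 := hP.jacobi _ _ _
    (isDiffFun_testDensity (b := fun p => a p.1) (by fun_prop) i)
    (isDiffFun_testDensity (b := fun p => b p.1) (by fun_prop) k)
    (isDiffFun_testDensity (b := fun p => c p.1) (by fun_prop) l)
  have h2 := eq_zero_of_integralZero hW h1 strictMonoOn_neg_inv (by norm_num)
    (T := fun x w v => -(
      jacobiTerm α β (a x) (deriv a x) (b x) (deriv b x) (c x) (deriv c x) i k l w v +
      jacobiTerm α β (b x) (deriv b x) (c x) (deriv c x) (a x) (deriv a x) k l i w v +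
      jacobiTerm α β (c x) (deriv c x) (a x) (deriv a x) (b x) (deriv b x) l i k w v)) ?_ x hw v
  · simpa only [neg_eq_zero] using h2
  · intro x z hz
    rw [decBracket_testDensity_decBracket hW hα hβ ha hb hc i k l hz,
      decBracket_testDensity_decBracket hW hα hβ hb hc ha k l i hz,
      decBracket_testDensity_decBracket hW hα hβ hc ha hb l i k hz]
    ring

/-- The torsion of the microscopic bracket vanishes. -/
theorem IsPoisson.torsion (hW : IsOpen W)
    (hα : ∀ k l, ContDiffOn ℝ ∞ (fun w => α w k l) W)
    (hβ : ∀ k l j, ContDiffOn ℝ ∞ (fun w => β w k l j) W) (hsymm : ∀ w ∈ W, (α w).IsSymm)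
    (hP : IsPoisson (fieldDomain W) (decBracket α β)) {w : Fin m → ℝ} (hw : w ∈ W)
    (i k l : Fin m) : ∑ n, α w i n * β w l k n = ∑ n, α w k n * β w l i n := by
  -- At `x = 0` and `∂ₓw = 0` only `a' = b' = c = 1` survive. The third cyclic term drops out, and
  -- compatibility turns `∂_n α_kl - β_kln` into `β_lkn` in the first.
  have h := hP.jacobiTerm_add hW hα hβ hw (a := fun x => x) (b := fun x => x) (c := fun _ => 1)
    contDiff_id contDiff_id contDiff_const i k l 0 0
  simp only [jacobiTerm, deriv_id'', deriv_const', ← hP.beta_add_beta hW hα hsymm hw,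
    Pi.zero_apply, mul_zero, zero_mul, Finset.sum_const_zero, add_zero, zero_add, one_mul, mul_one,
    zero_sub, add_sub_cancel_left, sub_self, mul_neg, Finset.sum_neg_distrib] at h
  linarith

/-- The curvature of the microscopic bracket vanishes. -/
theorem IsPoisson.curvature (hW : IsOpen W)
    (hα : ∀ k l, ContDiffOn ℝ ∞ (fun w => α w k l) W)
    (hβ : ∀ k l j, ContDiffOn ℝ ∞ (fun w => β w k l j) W) (hsymm : ∀ w ∈ W, (α w).IsSymm)
    (hP : IsPoisson (fieldDomain W) (decBracket α β)) {w : Fin m → ℝ} (hw : w ∈ W)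
    (i k l j : Fin m) :
    ∑ n, (α w i n * (fderiv ℝ (fun w => β w k l j) w (Pi.single n 1) -
      fderiv ℝ (fun w => β w k l n) w (Pi.single j 1)) - β w k n j * β w l i n +
      β w l n j * β w k i n) = 0 := by
  -- Now only `a' = b = c = 1` survive at `x = 0`, and `∂ₓw = e_j`. The first term gives the
  -- derivatives of `β`, the other two the quadratic terms.
  have h := hP.jacobiTerm_add hW hα hβ hw (a := fun x => x) (b := fun _ => 1) (c := fun _ => 1)
    contDiff_id contDiff_const contDiff_const i k l 0 (Pi.single j 1)
  simp only [jacobiTerm, deriv_id'', deriv_const', ← hP.beta_add_beta hW hα hsymm hw,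
    Pi.single_apply, mul_ite, Finset.sum_ite_eq', Finset.mem_univ, if_true,
    mul_zero, zero_mul, add_zero, zero_add, one_mul, mul_one,
    zero_sub] at h
  rw [← h, ← Finset.sum_add_distrib, ← Finset.sum_add_distrib]
  refine Finset.sum_congr rfl fun n _ => ?_
  ring

end Fields


/-! ### Linear total differential systems -/

section Frobenius

variable {E F : Type*} [NormedAddCommGroup E] [NormedSpace ℝ E] [NormedAddCommGroup F]
  [NormedSpace ℝ F]

/-- Second order Taylor estimate from a Lipschitz bound on the derivative. -/
theorem norm_taylor_le_of_lipschitz_fderiv {G : Type*} [NormedAddCommGroup G] [NormedSpace ℝ G]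
    {A : E → G} {s : Set E} (hs : Convex ℝ s) (hA : ∀ w ∈ s, DifferentiableAt ℝ A w) {L : ℝ}
    (hL : ∀ v ∈ s, ∀ w ∈ s, ‖fderiv ℝ A w - fderiv ℝ A v‖ ≤ L * ‖w - v‖) (hL0 : 0 ≤ L)
    {v w : E} (hv : v ∈ s) (hw : w ∈ s) :
    ‖A w - A v - fderiv ℝ A v (w - v)‖ ≤ L * ‖w - v‖ * ‖w - v‖ := by
  have hseg : segment ℝ v w ⊆ s := hs.segment_subset hv hw
  refine Convex.norm_image_sub_le_of_norm_hasFDerivWithin_le' (s := segment ℝ v w)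
    (f' := fderiv ℝ A) (fun z hz => (hA z (hseg hz)).hasFDerivAt.hasFDerivWithinAt)
    (fun z hz => (hL v hv z (hseg hz)).trans ?_) (convex_segment v w) (left_mem_segment ℝ v w)
    (right_mem_segment ℝ v w)
  refine mul_le_mul_of_nonneg_left ?_ hL0
  obtain ⟨t, ht, rfl⟩ := (segment_eq_image' ℝ v w ▸ hz :)
  rw [add_sub_cancel_left, norm_smul, Real.norm_of_nonneg ht.1]
  exact mul_le_of_le_one_left (norm_nonneg _) ht.2

/-- The uniform bounds near a point that a smooth coefficient map satisfies. -/
theorem exists_ball_bounds {G : Type*} [NormedAddCommGroup G] [NormedSpace ℝ G] {A : E → G}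
    {U : Set E} (hU : IsOpen U) (hA : ContDiffOn ℝ ∞ A U) {w₀ : E} (hw₀ : w₀ ∈ U) :
    ∃ r > 0, ∃ M ≥ 0, Metric.ball w₀ r ⊆ U ∧ r * M ≤ 1 / 2 ∧
      (∀ w ∈ Metric.ball w₀ r, ‖A w‖ ≤ M) ∧ (∀ w ∈ Metric.ball w₀ r, ‖fderiv ℝ A w‖ ≤ M) ∧
      (∀ v ∈ Metric.ball w₀ r, ∀ w ∈ Metric.ball w₀ r,
        ‖fderiv ℝ A w - fderiv ℝ A v‖ ≤ M * ‖w - v‖) := by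
  have hA' : ContDiffOn ℝ ∞ (fderiv ℝ A) U := hA.fderiv_of_isOpen hU (by simp)
  have hAt := hA.contDiffAt (hU.mem_nhds hw₀)
  have hAt' := hA'.contDiffAt (hU.mem_nhds hw₀)
  obtain ⟨K, t, ht, hK⟩ := (hAt'.of_le (m := 1) (by simp)).exists_lipschitzOnWith
  have e1 : ∀ᶠ w in nhds w₀, ‖A w‖ < ‖A w₀‖ + 1 :=
    hAt.continuousAt.norm.eventually (gt_mem_nhds (by linarith))
  have e2 : ∀ᶠ w in nhds w₀, ‖fderiv ℝ A w‖ < ‖fderiv ℝ A w₀‖ + 1 :=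
    hAt'.continuousAt.norm.eventually (gt_mem_nhds (by linarith))
  obtain ⟨r, hr, hball⟩ := Metric.eventually_nhds_iff_ball.1
    ((e1.and e2).and ((hU.eventually_mem hw₀).and ht))
  have hM : 0 ≤ ‖A w₀‖ + ‖fderiv ℝ A w₀‖ + K + 1 := by positivity
  -- A single `M` serves for all three bounds. Shrinking the radius to at most `1/(2M)` lets
  -- Picard–Lindelöf run along rays up to time one.
  refine ⟨min r (1 / (2 * (‖A w₀‖ + ‖fderiv ℝ A w₀‖ + K + 1))), by positivity,
    ‖A w₀‖ + ‖fderiv ℝ A w₀‖ + K + 1, hM, fun w hw => ?_, ?_, fun w hw => ?_, fun w hw => ?_,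
    fun v hv w hw => ?_⟩
  · exact (hball w (Metric.ball_subset_ball (min_le_left _ _) hw)).2.1
  · refine (mul_le_mul_of_nonneg_right (min_le_right _ _) hM).trans (le_of_eq ?_)
    field_simp
  · have := (hball w (Metric.ball_subset_ball (min_le_left _ _) hw)).1.1
    have := norm_nonneg (fderiv ℝ A w₀)
    have := K.2
    linarith
  · have := (hball w (Metric.ball_subset_ball (min_le_left _ _) hw)).1.2
    have := norm_nonneg (A w₀)
    have := K.2
    linarith
  · have h := hK.dist_le_mul w (hball w (Metric.ball_subset_ball (min_le_left _ _) hw)).2.2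
      v (hball v (Metric.ball_subset_ball (min_le_left _ _) hv)).2.2
    rw [dist_eq_norm, dist_eq_norm] at h
    refine h.trans (mul_le_mul_of_nonneg_right ?_ (norm_nonneg _))
    have := norm_nonneg (A w₀)
    have := norm_nonneg (fderiv ℝ A w₀)
    linarith

/-- Solutions of the linear equation along a ray, on the unit time interval. -/
theorem exists_ray_solution [CompleteSpace F] {A : E → E →L[ℝ] F →L[ℝ] F} {w₀ d : E} {r M : ℝ}
    (hc : ContinuousOn A (Metric.ball w₀ r)) (hM : ∀ w ∈ Metric.ball w₀ r, ‖A w‖ ≤ M)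
    (hM0 : 0 ≤ M) (hrM : r * M ≤ 1 / 2) (hd : ‖d‖ < r) (y₀ : F) :
    ∃ y : ℝ → F, y 0 = y₀ ∧ ∀ t ∈ Set.Icc (0 : ℝ) 1,
      HasDerivWithinAt y (A (w₀ + t • d) d (y t)) (Set.Icc 0 1) t := by
  have hmem : ∀ t ∈ Set.Icc (0 : ℝ) 1, w₀ + t • d ∈ Metric.ball w₀ r := by
    intro t ht
    rw [mem_ball_iff_norm, add_sub_cancel_left, norm_smul, Real.norm_of_nonneg ht.1]
    exact (mul_le_of_le_one_left (norm_nonneg _) ht.2).trans_lt hd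
  have hle : ∀ t ∈ Set.Icc (0 : ℝ) 1, ‖A (w₀ + t • d) d‖ ≤ 1 / 2 := by
    intro t ht
    calc ‖A (w₀ + t • d) d‖ ≤ ‖A (w₀ + t • d)‖ * ‖d‖ := ContinuousLinearMap.le_opNorm _ _
      _ ≤ M * r := by gcongr; exact hM _ (hmem t ht)
      _ ≤ 1 / 2 := by linarith
  -- In the ball of radius `‖y₀‖` about `y₀` one has `‖y‖ ≤ 2‖y₀‖`. The operator norm is at most
  -- `1/2`, so the speed is at most `‖y₀‖` and the solution stays in the ball during unit time.
  have hPL : IsPicardLindelof (fun t y => A (w₀ + t • d) d y)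
      (⟨0, by simp⟩ : Set.Icc (0 : ℝ) 1) y₀ ‖y₀‖₊ 0 ‖y₀‖₊ 1 := by
    refine ⟨fun t ht => ?_, fun y _ => ?_, fun t ht y hy => ?_, by simp⟩
    · refine LipschitzWith.lipschitzOnWith ((A (w₀ + t • d) d).lipschitz.weaken ?_)
      rw [← NNReal.coe_le_coe, coe_nnnorm]
      exact (hle t ht).trans (by norm_num)
    · have h1 : ContinuousOn (fun t : ℝ => A (w₀ + t • d)) (Set.Icc 0 1) :=
        hc.comp (Continuous.continuousOn (by fun_prop)) hmem
      exact (h1.clm_apply continuousOn_const).clm_apply continuousOn_const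
    · have hy' : ‖y‖ ≤ 2 * ‖y₀‖ := by
        have h1 : ‖y - y₀‖ ≤ ‖y₀‖ := by simpa [dist_eq_norm] using hy
        have h2 : ‖y‖ ≤ ‖y - y₀‖ + ‖y₀‖ := by simpa using norm_add_le (y - y₀) y₀
        linarith
      calc ‖A (w₀ + t • d) d y‖ ≤ ‖A (w₀ + t • d) d‖ * ‖y‖ := ContinuousLinearMap.le_opNorm _ _
        _ ≤ 1 / 2 * (2 * ‖y₀‖) := by gcongr; exact hle t ht
        _ = ‖y₀‖₊ := by simp
  obtain ⟨y, hy0, hy⟩ := hPL.exists_eq_forall_mem_Icc_hasDerivWithinAt₀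
  exact ⟨y, hy0, hy⟩

/-- **Frobenius theorem** for linear total differential systems: a system `∂Y = A(w) Y` that
satisfies the integrability condition has local solutions with arbitrary initial value. -/
theorem exists_solution_of_integrable [CompleteSpace F] {A : E → E →L[ℝ] F →L[ℝ] F} {U : Set E}
    (hU : IsOpen U) (hA : ContDiffOn ℝ ∞ A U)
    (hint : ∀ w ∈ U, ∀ h k y, fderiv ℝ A w h k y + A w k (A w h y)
      = fderiv ℝ A w k h y + A w h (A w k y)) {w₀ : E} (hw₀ : w₀ ∈ U) :
    ∃ r > 0, Metric.ball w₀ r ⊆ U ∧ ∀ y₀ : F, ∃ Y : E → F, Y w₀ = y₀ ∧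
      ∀ w ∈ Metric.ball w₀ r, HasFDerivAt Y ((A w).flip (Y w)) w := by
  obtain ⟨r, hr, M, hM0, hrU, hrM, hMA, hMA', hML⟩ := exists_ball_bounds hU hA hw₀
  refine ⟨r, hr, hrU, fun y₀ => ?_⟩
  have hc : ContinuousOn A (Metric.ball w₀ r) := hA.continuousOn.mono hrU
  have hdiff : ∀ w ∈ Metric.ball w₀ r, DifferentiableAt ℝ A w := fun w hw =>
    (hA.contDiffAt (hU.mem_nhds (hrU hw))).differentiableAt (by simp)
  -- The bound on `d` is put after the existential so that one function `Θ` can be chosen for all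
  -- `d`; for large `d` its value is irrelevant.
  have hex : ∀ d : E, ∃ y : ℝ → F, ‖d‖ < r → y 0 = y₀ ∧ ∀ t ∈ Set.Icc (0 : ℝ) 1,
      HasDerivWithinAt y (A (w₀ + t • d) d (y t)) (Set.Icc 0 1) t := by
    intro d
    by_cases hd : ‖d‖ < r
    · obtain ⟨y, hy⟩ := exists_ray_solution hc hMA hM0 hrM hd y₀
      exact ⟨y, fun _ => hy⟩
    · exact ⟨0, fun h => absurd h hd⟩
  choose Θ hΘ using hex
  have hray : ∀ d : E, ‖d‖ < r → ∀ t ∈ Set.Icc (0 : ℝ) 1, w₀ + t • d ∈ Metric.ball w₀ r := by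
    intro d hd t ht
    rw [mem_ball_iff_norm, add_sub_cancel_left, norm_smul, Real.norm_of_nonneg ht.1]
    exact (mul_le_of_le_one_left (norm_nonneg _) ht.2).trans_lt hd
  -- The candidate solution transports `y₀` along the ray from `w₀` to `w`.
  refine ⟨fun w => Θ (w - w₀) 1, ?_, fun w hw => ?_⟩
  · have h0 := hΘ 0 (by simpa using hr)
    have hconst : ∀ t ∈ Set.Icc (0 : ℝ) 1, Θ 0 t = Θ 0 0 := by
      refine constant_of_derivWithin_zero (fun t ht => (h0.2 t ht).differentiableWithinAt)
        fun t ht => ?_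
      have ht' : t ∈ Set.Icc (0 : ℝ) 1 := ⟨ht.1, ht.2.le⟩
      rw [(h0.2 t ht').derivWithin (uniqueDiffOn_Icc zero_lt_one t ht')]
      simp
    simp [hconst 1 (by simp), h0.1]
  · set d := w - w₀ with hd_def
    have hd : ‖d‖ < r := mem_ball_iff_norm.1 hw
    have hΘc : ContinuousOn (Θ d) (Set.Icc 0 1) := fun t ht =>
      ((hΘ d hd).2 t ht).continuousWithinAt
    obtain ⟨C, hC⟩ := isCompact_Icc.exists_bound_of_continuousOn hΘc
    have hC0 : 0 ≤ C := (norm_nonneg _).trans (hC 0 (by simp))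
    have hw1 : w₀ + d = w := by simp [hd_def]
    -- the approximate solution along a neighbouring ray
    have key : ∀ h : E, ‖d + h‖ < r → ‖Θ (d + h) 1 - (Θ d 1 + A w h (Θ d 1))‖ ≤
        gronwallBound 0 1 (C * (M * r + M + M * M + M * r * M) * ‖h‖ ^ 2) 1 := by
      intro h hh
      set ε := C * (M * r + M + M * M + M * r * M) * ‖h‖ ^ 2 with hε
      have hIci : ∀ t ∈ Set.Ico (0 : ℝ) 1, Set.Icc (0 : ℝ) 1 ∈ nhdsWithin t (Set.Ici t) :=
        fun t ht => Icc_mem_nhdsGE_of_mem ht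
      have hYd : ∀ t ∈ Set.Icc (0 : ℝ) 1, HasDerivWithinAt
          (fun t => Θ d t + t • A (w₀ + t • d) h (Θ d t))
          (A (w₀ + t • d) d (Θ d t) + (t • (fderiv ℝ A (w₀ + t • d) d h (Θ d t)
            + A (w₀ + t • d) h (A (w₀ + t • d) d (Θ d t))) + A (w₀ + t • d) h (Θ d t)))
          (Set.Icc 0 1) t := by
        intro t ht
        have h1 := (hΘ d hd).2 t ht
        have h2 : HasDerivAt (fun t : ℝ => w₀ + t • d) d t := by
          simpa using ((hasDerivAt_id t).smul_const d).const_add w₀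
        have h0 : HasFDerivAt A (fderiv ℝ A (w₀ + t • d)) (w₀ + t • d) :=
          (hdiff _ (hray d hd t ht)).hasFDerivAt
        have h3 : HasDerivAt (fun t : ℝ => A (w₀ + t • d)) (fderiv ℝ A (w₀ + t • d) d) t :=
          HasFDerivAt.comp_hasDerivAt (l := A) (f := fun t : ℝ => w₀ + t • d) t h0 h2
        have h4 : HasDerivAt (fun t : ℝ => A (w₀ + t • d) h) (fderiv ℝ A (w₀ + t • d) d h) t := by
          simpa using h3.clm_apply (hasDerivAt_const t h)
        have h5 := h4.hasDerivWithinAt (s := Set.Icc 0 1).clm_apply h1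
        have h6 := h1.add ((hasDerivAt_id t).hasDerivWithinAt (s := Set.Icc 0 1).smul h5)
        exact h6.congr_deriv (by simp)
      have hYc : ContinuousOn (fun t => Θ d t + t • A (w₀ + t • d) h (Θ d t)) (Set.Icc 0 1) :=
        fun t ht => (hYd t ht).continuousWithinAt
      -- Grönwall compares the exact solution along `d + h` with `Θ d t + t A(w₀ + t d) h (Θ d t)`.
      -- Both start at `y₀`, and the second solves the equation up to a defect `ε` of order `‖h‖²`.
      have hg := dist_le_of_approx_trajectories_ODE_of_mem (K := 1) (a := 0) (b := 1)
        (v := fun t y => A (w₀ + t • (d + h)) (d + h) y) (s := fun _ => Set.univ)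
        (f := Θ (d + h)) (g := fun t => Θ d t + t • A (w₀ + t • d) h (Θ d t))
        (εf := 0) (εg := ε) (δ := 0) ?_
        (fun t ht => ((hΘ (d + h) hh).2 t ht).continuousWithinAt)
        (fun t ht => ((hΘ (d + h) hh).2 t ⟨ht.1, ht.2.le⟩).mono_of_mem_nhdsWithin (hIci t ht))
        (fun t _ => by simp) (fun _ _ => trivial) hYc
        (fun t ht => (hYd t ⟨ht.1, ht.2.le⟩).mono_of_mem_nhdsWithin (hIci t ht)) ?_
        (fun _ _ => trivial) (by simp [(hΘ (d + h) hh).1, (hΘ d hd).1]) 1 (by simp)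
      · simpa only [dist_eq_norm, hw1, one_smul, zero_add, sub_zero, NNReal.coe_one] using hg
      · intro t ht
        refine LipschitzWith.lipschitzOnWith
          ((A (w₀ + t • (d + h)) (d + h)).lipschitz.weaken ?_)
        rw [← NNReal.coe_le_coe, coe_nnnorm]
        calc _ ≤ ‖A (w₀ + t • (d + h))‖ * ‖d + h‖ := ContinuousLinearMap.le_opNorm _ _
          _ ≤ M * r := by gcongr; exact hMA _ (hray _ hh t ⟨ht.1, ht.2.le⟩)
          _ ≤ (1 : NNReal) := by simp; linarith
      · intro t ht
        have ht' : t ∈ Set.Icc (0 : ℝ) 1 := ⟨ht.1, ht.2.le⟩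
        have hv := hray d hd t ht'
        have hv' := hray (d + h) hh t ht'
        set v := w₀ + t • d with hv_def
        set v' := w₀ + t • (d + h) with hv'_def
        set y := Θ d t
        have hy : ‖y‖ ≤ C := hC t ht'
        have hvv : v' - v = t • h := by simp [hv_def, hv'_def]
        have hth : ‖t • h‖ ≤ ‖h‖ := by
          rw [norm_smul, Real.norm_of_nonneg ht.1]
          exact mul_le_of_le_one_left (norm_nonneg _) ht.2.le
        have hr0 : 0 ≤ r := hr.le
        have b1 : ‖A v' - A v - fderiv ℝ A v (t • h)‖ ≤ M * ‖h‖ * ‖h‖ := by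
          have := norm_taylor_le_of_lipschitz_fderiv (convex_ball w₀ r) hdiff hML hM0 hv hv'
          rw [hvv] at this
          exact this.trans (by gcongr)
        have b2 : ‖A v' - A v‖ ≤ M * ‖h‖ := by
          have := (convex_ball w₀ r).norm_image_sub_le_of_norm_fderiv_le hdiff hMA' hv hv'
          rw [hvv] at this
          exact this.trans (by gcongr)
        have n1 : ‖(A v' - A v - fderiv ℝ A v (t • h)) (d + h) y‖ ≤ M * ‖h‖ * ‖h‖ * r * C :=
          (ContinuousLinearMap.le_opNorm₂ _ _ _).trans (by gcongr)
        have n2 : ‖fderiv ℝ A v (t • h) h y‖ ≤ M * ‖h‖ * ‖h‖ * C := by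
          refine (ContinuousLinearMap.le_opNorm₂ _ _ _).trans ?_
          gcongr
          exact (ContinuousLinearMap.le_opNorm _ _).trans
            (mul_le_mul (hMA' v hv) hth (norm_nonneg _) hM0)
        have n0 : ‖A v h y‖ ≤ M * ‖h‖ * C :=
          (ContinuousLinearMap.le_opNorm₂ _ _ _).trans (by gcongr; exact hMA v hv)
        have n3 : ‖A v (t • h) (A v h y)‖ ≤ M * ‖h‖ * (M * ‖h‖ * C) :=
          (ContinuousLinearMap.le_opNorm₂ _ _ _).trans (by gcongr; exact hMA v hv)
        have n4 : ‖(A v' - A v) (d + h) (t • A v h y)‖ ≤ M * ‖h‖ * r * (M * ‖h‖ * C) := by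
          refine (ContinuousLinearMap.le_opNorm₂ _ _ _).trans ?_
          gcongr
          rw [norm_smul, Real.norm_of_nonneg ht.1]
          exact (mul_le_of_le_one_left (norm_nonneg _) ht.2.le).trans n0
        -- Integrability exchanges `h` and `d` in the terms of first order. They then agree with the
        -- expansion of `A v' (d + h)` applied to the approximate solution, and only terms quadratic
        -- in `h` remain.
        have hI := hint v (hrU hv) h d y
        have hsplit : A v d y + (t • (fderiv ℝ A v d h y + A v h (A v d y)) + A v h y)
            - A v' (d + h) (y + t • A v h y) =
            -((A v' - A v - fderiv ℝ A v (t • h)) (d + h) y + fderiv ℝ A v (t • h) h y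
              + A v (t • h) (A v h y) + (A v' - A v) (d + h) (t • A v h y)) := by
          rw [← hI]
          simp only [map_add, map_smul, add_apply,
            sub_apply, smul_apply, smul_add]
          module
        rw [dist_eq_norm, hsplit, norm_neg]
        refine (norm_add_le_of_le (norm_add_le_of_le (norm_add_le_of_le n1 n2) n3) n4).trans
          (le_of_eq ?_)
        rw [hε]
        ring
    rw [hasFDerivAt_iff_isLittleO_nhds_zero]
    have hO : (fun h => Θ (w + h - w₀) 1 - Θ (w - w₀) 1 - (A w).flip (Θ (w - w₀) 1) h)
        =O[nhds 0] fun h : E => ‖h‖ ^ 2 := by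
      refine Asymptotics.IsBigO.of_bound
        (C * (M * r + M + M * M + M * r * M) * (Real.exp 1 - 1)) ?_
      have hev : ∀ᶠ h in nhds (0 : E), ‖d + h‖ < r := by
        have : ContinuousAt (fun h : E => ‖d + h‖) 0 := by fun_prop
        exact this.eventually (gt_mem_nhds (by simpa using hd))
      filter_upwards [hev] with h hh
      have := key h hh
      rw [gronwallBound_of_K_ne_0 one_ne_zero] at this
      have e : w + h - w₀ = d + h := by rw [hd_def]; abel
      rw [e, ← hd_def, ContinuousLinearMap.flip_apply, sub_sub]
      refine this.trans (le_of_eq ?_)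
      simp
      ring
    refine hO.trans_isLittleO ?_
    simpa using (Asymptotics.isLittleO_norm_pow_id (E' := E) one_lt_two)

/-- Solutions of a smooth linear total differential system are smooth. -/
theorem contDiffOn_of_hasFDerivAt_flip {A : E → E →L[ℝ] F →L[ℝ] F} {V : Set E} (hV : IsOpen V)
    (hA : ContDiffOn ℝ ∞ A V) {Y : E → F}
    (hY : ∀ w ∈ V, HasFDerivAt Y ((A w).flip (Y w)) w) : ContDiffOn ℝ ∞ Y V := by
  rw [contDiffOn_infty]
  intro n
  induction n with
  | zero =>
    exact contDiffOn_zero.2 fun w hw => (hY w hw).continuousAt.continuousWithinAt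
  | succ n ih =>
    -- The equation expresses the derivative of `Y` through `A` and `Y`, so each order of smoothness
    -- yields the next one.
    rw [Nat.cast_succ, contDiffOn_succ_iff_fderiv_of_isOpen hV]
    refine ⟨fun w hw => (hY w hw).differentiableAt.differentiableWithinAt, by simp, ?_⟩
    have h0 : ContDiff ℝ n (fun B : E →L[ℝ] F →L[ℝ] F => B.flip) :=
      IsBoundedLinearMap.contDiff (f := fun B : E →L[ℝ] F →L[ℝ] F => B.flip)
        ⟨⟨fun _ _ => rfl, fun _ _ => rfl⟩, 1, one_pos, fun B => by
          rw [one_mul, ContinuousLinearMap.opNorm_flip]⟩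
    have h1 : ContDiffOn ℝ n (fun w => (A w).flip (Y w)) V :=
      (h0.comp_contDiffOn (contDiffOn_infty.1 hA n)).clm_apply ih
    exact h1.congr fun w hw => (hY w hw).fderiv

theorem contDiffOn_sum_smul {G κ : Type*} [NormedAddCommGroup G] [NormedSpace ℝ G] [Fintype κ]
    (e : κ → G) {c : E → κ → ℝ} {s : Set E} (hc : ∀ t, ContDiffOn ℝ ∞ (fun w => c w t) s) :
    ContDiffOn ℝ ∞ (fun w => ∑ t, c w t • e t) s :=
  ContDiffOn.sum fun t _ => (hc t).smul contDiffOn_const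

/-- The linear system `∂_h y = ∑ c_t u_t(h) φ_t(y) e_t` with scalar coefficients `c_t`. -/
def coeffSystem {κ : Type*} [Fintype κ] (u : κ → E →L[ℝ] ℝ) (φ : κ → F →L[ℝ] ℝ) (e : κ → F)
    (c : κ → ℝ) (h : E) (y : F) : F := ∑ t, (c t * (u t h * φ t y)) • e t

/-- The Frobenius theorem for linear systems given by scalar coefficients. -/
theorem exists_solution_coeffSystem [CompleteSpace F] {κ : Type*} [Fintype κ]
    {u : κ → E →L[ℝ] ℝ} {φ : κ → F →L[ℝ] ℝ} {e : κ → F} {c : E → κ → ℝ} {U : Set E}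
    (hU : IsOpen U) (hc : ∀ t, ContDiffOn ℝ ∞ (fun w => c w t) U)
    (hint : ∀ w ∈ U, ∀ h k y,
      coeffSystem u φ e (fun t => fderiv ℝ (fun w => c w t) w h) k y +
        coeffSystem u φ e (c w) k (coeffSystem u φ e (c w) h y) =
      coeffSystem u φ e (fun t => fderiv ℝ (fun w => c w t) w k) h y +
        coeffSystem u φ e (c w) h (coeffSystem u φ e (c w) k y)) {w₀ : E} (hw₀ : w₀ ∈ U) :
    ∃ r > 0, Metric.ball w₀ r ⊆ U ∧ ∀ y₀ : F, ∃ Y : E → F, Y w₀ = y₀ ∧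
      ContDiffOn ℝ ∞ Y (Metric.ball w₀ r) ∧ ∀ w ∈ Metric.ball w₀ r, ∃ L : E →L[ℝ] F,
        HasFDerivAt Y L w ∧ ∀ h, L h = coeffSystem u φ e (c w) h (Y w) := by
  -- A sum of fixed operators with scalar coefficients: smoothness and derivatives of `A` reduce to
  -- those of the `c_t`.
  set A : E → E →L[ℝ] F →L[ℝ] F := fun w => ∑ t, c w t • (u t).smulRight ((φ t).smulRight (e t))
    with hAdef
  have hA : ContDiffOn ℝ ∞ A U := contDiffOn_sum_smul _ hc
  have hAa : ∀ w h y, A w h y = coeffSystem u φ e (c w) h y := by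
    intro w h y
    simp [hAdef, coeffSystem, sum_apply, smul_smul, mul_assoc]
  have hA' : ∀ w ∈ U, ∀ h k y, fderiv ℝ A w h k y =
      coeffSystem u φ e (fun t => fderiv ℝ (fun w => c w t) w h) k y := by
    intro w hw h k y
    have hAw : HasFDerivAt A (fderiv ℝ A w) w :=
      ((hA.contDiffAt (hU.mem_nhds hw)).differentiableAt (by simp)).hasFDerivAt
    have h1 := (hAw.clm_apply (hasFDerivAt_const k w)).clm_apply (hasFDerivAt_const y w)
    have h2 : HasFDerivAt (fun w => A w k y) (∑ t, ((u t k * φ t y) •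
        fderiv ℝ (fun w => c w t) w).smulRight (e t)) w := by
      simp only [hAa, coeffSystem]
      exact HasFDerivAt.fun_sum fun t _ => ((((hc t).contDiffAt (hU.mem_nhds hw)).differentiableAt
        (by simp)).hasFDerivAt.mul_const _).smul_const _
    have h3 := congrArg (fun L : E →L[ℝ] F => L h) (h1.unique h2)
    simp only [sum_apply, ContinuousLinearMap.smulRight_apply, smul_apply, smul_eq_mul] at h3
    simpa [coeffSystem, mul_comm] using h3
  obtain ⟨r, hr, hrU, hex⟩ := exists_solution_of_integrable hU hA
    (fun w hw h k y => by simpa only [hA' w hw, hAa] using hint w hw h k y) hw₀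
  refine ⟨r, hr, hrU, fun y₀ => ?_⟩
  obtain ⟨Y, hY0, hY⟩ := hex y₀
  exact ⟨Y, hY0, contDiffOn_of_hasFDerivAt_flip Metric.isOpen_ball (hA.mono hrU) hY,
    fun w hw => ⟨_, hY w hw, fun h => hAa w h (Y w)⟩⟩

end Frobenius


/-! ### Microscopic brackets of zero torsion and curvature -/

section Microscopic

variable {m : ℕ} {V W : Set (Fin m → ℝ)} {α : (Fin m → ℝ) → Matrix (Fin m) (Fin m) ℝ}
  {β : (Fin m → ℝ) → Fin m → Fin m → Fin m → ℝ}

/-- The partial derivative `∂F/∂w_j`. -/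
noncomputable abbrev pd (F : (Fin m → ℝ) → ℝ) (j : Fin m) (w : Fin m → ℝ) : ℝ :=
  fderiv ℝ F w (Pi.single j 1)

/-- The coefficients of a bracket `∫ ∂ₓF_k α_kl G_l + F_k β_kl G_l dx` with a non-degenerate metric
and a compatible connection without torsion and curvature. -/
structure IsFlatBracket (α : (Fin m → ℝ) → Matrix (Fin m) (Fin m) ℝ)
    (β : (Fin m → ℝ) → Fin m → Fin m → Fin m → ℝ) (W : Set (Fin m → ℝ)) : Prop where
  isOpen : IsOpen W
  contDiffOn_alpha : ∀ k l, ContDiffOn ℝ ∞ (fun w => α w k l) W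
  contDiffOn_beta : ∀ k l j, ContDiffOn ℝ ∞ (fun w => β w k l j) W
  isSymm : ∀ w ∈ W, (α w).IsSymm
  det_ne_zero : ∀ w ∈ W, (α w).det ≠ 0
  compatible : ∀ w ∈ W, ∀ k l j, β w k l j + β w l k j = pd (fun w => α w k l) j w
  torsion : ∀ w ∈ W, ∀ i k l, ∑ n, α w i n * β w l k n = ∑ n, α w k n * β w l i n
  curvature : ∀ w ∈ W, ∀ i k l j,
    ∑ n, (α w i n * (pd (fun w => β w k l j) n w - pd (fun w => β w k l n) j w) -
      β w k n j * β w l i n + β w l n j * β w k i n) = 0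

theorem IsPoisson.isFlatBracket (hW : IsOpen W)
    (hα : ∀ k l, ContDiffOn ℝ ∞ (fun w => α w k l) W)
    (hβ : ∀ k l j, ContDiffOn ℝ ∞ (fun w => β w k l j) W) (hsymm : ∀ w ∈ W, (α w).IsSymm)
    (hdet : ∀ w ∈ W, (α w).det ≠ 0)
    (hP : IsPoisson (fieldDomain W) (decBracket α β)) : IsFlatBracket α β W where
  isOpen := hW
  contDiffOn_alpha := hα
  contDiffOn_beta := hβ
  isSymm := hsymm
  det_ne_zero := hdet
  compatible _ hw k l j := hP.beta_add_beta hW hα hsymm hw k l j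
  torsion _ hw i k l := hP.torsion hW hα hβ hsymm hw i k l
  curvature _ hw i k l j := hP.curvature hW hα hβ hsymm hw i k l j

theorem det_ne_zero_of_decMetric (h : ∀ v ∈ fieldDomain W, (decMetric α v).det ≠ 0)
    {w : Fin m → ℝ} (hw : w ∈ W) : (α w).det ≠ 0 := by
  -- At `ρ = 1` the lower block of the metric is exactly `α w`.
  have h1 := h (Sum.elim ![1, 0] w) ⟨by simp, by simpa using hw⟩
  intro h0
  refine h1 ?_
  rw [decMetric, Matrix.det_fromBlocks_zero₁₂]
  simp [h0]

/-- The matrix `β_j` with entries `β_klj`. -/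
def betaMatrix (β : (Fin m → ℝ) → Fin m → Fin m → Fin m → ℝ) (w : Fin m → ℝ) (j : Fin m) :
    Matrix (Fin m) (Fin m) ℝ := Matrix.of fun k l => β w k l j

/-- The connection matrix `Γ_j = -β_j α⁻¹`. -/
noncomputable def connMatrix (α : (Fin m → ℝ) → Matrix (Fin m) (Fin m) ℝ)
    (β : (Fin m → ℝ) → Fin m → Fin m → Fin m → ℝ) (w : Fin m → ℝ) (j : Fin m) :
    Matrix (Fin m) (Fin m) ℝ := -(betaMatrix β w j * (α w)⁻¹)

theorem contDiffOn_det {A : (Fin m → ℝ) → Matrix (Fin m) (Fin m) ℝ}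
    (hA : ∀ k l, ContDiffOn ℝ ∞ (fun w => A w k l) W) :
    ContDiffOn ℝ ∞ (fun w => (A w).det) W := by
  simp only [Matrix.det_apply']
  exact ContDiffOn.sum fun σ _ => contDiffOn_const.mul (contDiffOn_prod fun i _ => hA _ _)

/-- Cramer's rule: the inverse is the adjugate, polynomial in the entries, divided by the
determinant. -/
theorem contDiffOn_inv {A : (Fin m → ℝ) → Matrix (Fin m) (Fin m) ℝ}
    (hA : ∀ k l, ContDiffOn ℝ ∞ (fun w => A w k l) W) (hdet : ∀ w ∈ W, (A w).det ≠ 0)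
    (k l : Fin m) : ContDiffOn ℝ ∞ (fun w => (A w)⁻¹ k l) W := by
  have h1 : ContDiffOn ℝ ∞ (fun w => (A w).adjugate k l) W := by
    simp only [Matrix.adjugate_apply]
    refine contDiffOn_det fun i j => ?_
    by_cases hi : i = l
    · simpa [Matrix.updateRow_apply, hi] using contDiffOn_const
    · simpa [Matrix.updateRow_apply, hi] using hA i j
  refine (((contDiffOn_det hA).inv hdet).mul h1).congr fun w _ => ?_
  simp [Matrix.inv_def]

/-! ### Symmetry and integrability of the connection -/

namespace IsFlatBracket

variable (h : IsFlatBracket α β W)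
include h

theorem isUnit_det {w : Fin m → ℝ} (hw : w ∈ W) : IsUnit (α w).det :=
  (h.det_ne_zero w hw).isUnit

theorem contDiffOn_conn (j r p : Fin m) :
    ContDiffOn ℝ ∞ (fun w => connMatrix α β w j r p) W := by
  simp only [connMatrix, Matrix.neg_apply, Matrix.mul_apply]
  exact (ContDiffOn.sum fun q _ => (h.contDiffOn_beta r q j).mul
    (contDiffOn_inv h.contDiffOn_alpha h.det_ne_zero q p)).neg

theorem differentiableAt_alpha {w : Fin m → ℝ} (hw : w ∈ W) (k l : Fin m) :
    DifferentiableAt ℝ (fun w => α w k l) w :=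
  ((h.contDiffOn_alpha k l).contDiffAt (h.isOpen.mem_nhds hw)).differentiableAt (by simp)

theorem differentiableAt_conn {w : Fin m → ℝ} (hw : w ∈ W) (j r p : Fin m) :
    DifferentiableAt ℝ (fun w => connMatrix α β w j r p) w :=
  ((h.contDiffOn_conn j r p).contDiffAt (h.isOpen.mem_nhds hw)).differentiableAt (by simp)

theorem connMatrix_mul {w : Fin m → ℝ} (hw : w ∈ W) (j : Fin m) :
    connMatrix α β w j * α w = -betaMatrix β w j := by
  rw [connMatrix, neg_mul, Matrix.mul_assoc, Matrix.nonsing_inv_mul _ (h.isUnit_det hw),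
    Matrix.mul_one]

theorem isSymm_inv {w : Fin m → ℝ} (hw : w ∈ W) : ((α w)⁻¹).transpose = (α w)⁻¹ := by
  rw [Matrix.transpose_nonsing_inv, h.isSymm w hw]

/-- Vanishing torsion, in terms of the matrices `β_l` with entries `β_lqj`. -/
theorem inv_mul_of_torsion {w : Fin m → ℝ} (hw : w ∈ W) (l : Fin m) :
    (α w)⁻¹ * Matrix.of (β w l) = (Matrix.of (β w l)).transpose * (α w)⁻¹ := by
  have h1 : α w * (Matrix.of (β w l)).transpose = Matrix.of (β w l) * α w := by
    ext i k
    simp only [Matrix.mul_apply, Matrix.transpose_apply, Matrix.of_apply]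
    rw [h.torsion w hw i k l]
    refine Finset.sum_congr rfl fun n _ => ?_
    rw [mul_comm, (h.isSymm w hw).apply]
  have hu := h.isUnit_det hw
  calc (α w)⁻¹ * Matrix.of (β w l)
      = (α w)⁻¹ * (Matrix.of (β w l) * α w) * (α w)⁻¹ := by
        rw [Matrix.mul_assoc, Matrix.mul_assoc, Matrix.mul_nonsing_inv _ hu, Matrix.mul_one]
    _ = _ := by
        rw [← h1, ← Matrix.mul_assoc, Matrix.nonsing_inv_mul _ hu, Matrix.one_mul]

/-- For fixed `r` the array `Γ_jrp` is `-(β_rᵗ α⁻¹)_jp`, a symmetric matrix by `inv_mul_of_torsion`.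
Thus parallel covector fields are closed and have local potentials. -/
theorem connMatrix_symm {w : Fin m → ℝ} (hw : w ∈ W) (j r p : Fin m) :
    connMatrix α β w j r p = connMatrix α β w p r j := by
  have e : ∀ j p, connMatrix α β w j r p = -((Matrix.of (β w r)).transpose * (α w)⁻¹) j p := by
    intro j p
    simp [connMatrix, betaMatrix, Matrix.mul_apply]
  have hs : ((Matrix.of (β w r)).transpose * (α w)⁻¹).transpose =
      (Matrix.of (β w r)).transpose * (α w)⁻¹ := by
    rw [Matrix.transpose_mul, Matrix.transpose_transpose, h.isSymm_inv hw,
      h.inv_mul_of_torsion hw]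
  rw [e, e, ← congrFun (congrFun hs p) j, Matrix.transpose_apply]

/-- Vanishing curvature, in terms of the matrices `β_j`. -/
theorem curvature_matrix {w : Fin m → ℝ} (hw : w ∈ W) (s j : Fin m) :
    (Matrix.of fun k l => pd (fun w => β w k l j) s w) -
      (Matrix.of fun k l => pd (fun w => β w k l s) j w) =
    betaMatrix β w j * (α w)⁻¹ * (betaMatrix β w s).transpose -
      betaMatrix β w s * (α w)⁻¹ * (betaMatrix β w j).transpose := by
  have hu := h.isUnit_det hw
  ext k l
  -- The curvature identity gives `α D`. After inversion of `α`, vanishing torsion moves `α⁻¹`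
  -- between the two factors `β`.
  set D : Fin m → ℝ := fun n => pd (fun w => β w k l j) n w - pd (fun w => β w k l n) j w
  have h1 : ∀ i, (α w).mulVec D i = (Matrix.of (β w l)).mulVec (fun n => β w k n j) i -
      (Matrix.of (β w k)).mulVec (fun n => β w l n j) i := by
    intro i
    have := h.curvature w hw i k l j
    simp only [Finset.sum_add_distrib, Finset.sum_sub_distrib] at this
    simp only [Matrix.mulVec, dotProduct, Matrix.of_apply, D]
    simp only [mul_comm (β w l i _), mul_comm (β w k i _)]
    linarith
  have h2 : D = (α w)⁻¹.mulVec ((Matrix.of (β w l)).mulVec (fun n => β w k n j) -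
      (Matrix.of (β w k)).mulVec (fun n => β w l n j)) := by
    have h1' : (α w).mulVec D = (Matrix.of (β w l)).mulVec (fun n => β w k n j) -
      (Matrix.of (β w k)).mulVec (fun n => β w l n j) := funext h1
    rw [← h1', Matrix.mulVec_mulVec, Matrix.nonsing_inv_mul _ hu, Matrix.one_mulVec]
  have h3 := congrFun h2 s
  rw [Matrix.mulVec_sub, Matrix.mulVec_mulVec, Matrix.mulVec_mulVec, h.inv_mul_of_torsion hw,
    h.inv_mul_of_torsion hw] at h3
  have e1 : ∀ k l j s, ((Matrix.of (β w l)).transpose * (α w)⁻¹).mulVec (fun n => β w k n j) s =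
      (betaMatrix β w j * (α w)⁻¹ * (betaMatrix β w s).transpose) k l := by
    intro k l j s
    rw [Matrix.mul_assoc, Matrix.mul_apply]
    simp only [Matrix.mulVec, dotProduct, Matrix.mul_apply, Matrix.transpose_apply,
      Matrix.of_apply, betaMatrix]
    refine Finset.sum_congr rfl fun n _ => ?_
    rw [mul_comm]
    congr 1
    refine Finset.sum_congr rfl fun i _ => ?_
    rw [mul_comm, ← congrFun (congrFun (h.isSymm_inv hw) i) n, Matrix.transpose_apply]
  have e2 : (betaMatrix β w s * (α w)⁻¹ * (betaMatrix β w j).transpose) k l =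
      (betaMatrix β w j * (α w)⁻¹ * (betaMatrix β w s).transpose) l k := by
    rw [← Matrix.transpose_apply (betaMatrix β w j * _ * _)]
    simp only [Matrix.transpose_mul, Matrix.transpose_transpose, h.isSymm_inv hw,
      Matrix.mul_assoc]
  rw [Pi.sub_apply, e1, e1] at h3
  rw [Matrix.sub_apply, Matrix.sub_apply, e2]
  exact h3

/-- The integrability condition `∂_i Γ_j + Γ_i Γ_j = ∂_j Γ_i + Γ_j Γ_i`. -/
theorem connMatrix_integrable {w : Fin m → ℝ} (hw : w ∈ W) (i j : Fin m) :
    (Matrix.of fun s p => pd (fun w => connMatrix α β w j s p) i w) +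
      connMatrix α β w i * connMatrix α β w j =
    (Matrix.of fun s p => pd (fun w => connMatrix α β w i s p) j w) +
      connMatrix α β w j * connMatrix α β w i := by
  have hu := h.isUnit_det hw
  -- Differentiate `Γ_j α = -β_j` and replace `∂_i α` by `β_i + β_iᵗ`.
  have hd : ∀ i j, (Matrix.of fun s p => pd (fun w => connMatrix α β w j s p) i w) * α w =
      -(Matrix.of fun k l => pd (fun w => β w k l j) i w) -
        connMatrix α β w j * (betaMatrix β w i + (betaMatrix β w i).transpose) := by
    intro i j
    ext s q
    have h1 : HasFDerivAt (fun w => ∑ p, connMatrix α β w j s p * α w p q)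
        (∑ p, (connMatrix α β w j s p • fderiv ℝ (fun w => α w p q) w +
          α w p q • fderiv ℝ (fun w => connMatrix α β w j s p) w)) w :=
      HasFDerivAt.fun_sum fun p _ => (h.differentiableAt_conn hw j s p).hasFDerivAt.mul
        (h.differentiableAt_alpha hw p q).hasFDerivAt
    have h2 : (fun w => ∑ p, connMatrix α β w j s p * α w p q) =ᶠ[nhds w]
        fun w => -β w s q j := by
      filter_upwards [h.isOpen.mem_nhds hw] with w' hw'
      have := congrFun (congrFun (h.connMatrix_mul hw' j) s) q
      rwa [Matrix.mul_apply] at this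
    have h3 := congrArg (fun L : (Fin m → ℝ) →L[ℝ] ℝ => L (Pi.single i 1))
      (h1.fderiv.symm.trans (h2.fderiv_eq.trans fderiv_fun_neg))
    simp only [sum_apply, add_apply, smul_apply, smul_eq_mul, neg_apply,
      ← h.compatible w hw, Finset.sum_add_distrib] at h3
    simp only [Matrix.mul_apply, Matrix.sub_apply, Matrix.neg_apply, Matrix.of_apply,
      Matrix.add_apply, Matrix.transpose_apply, betaMatrix]
    simp only [mul_comm _ (α w _ q)]
    linarith
  -- The products `β_j α⁻¹ β_i` and `β_i α⁻¹ β_j` together are symmetric in `i, j`. What is left,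
  -- `-∂_i β_j + β_j α⁻¹ β_iᵗ`, is symmetric by `curvature_matrix`.
  have hS : ∀ i j, ((Matrix.of fun s p => pd (fun w => connMatrix α β w j s p) i w) +
      connMatrix α β w i * connMatrix α β w j) * α w =
      -(Matrix.of fun k l => pd (fun w => β w k l j) i w) +
        (betaMatrix β w j * (α w)⁻¹ * betaMatrix β w i +
          betaMatrix β w j * (α w)⁻¹ * (betaMatrix β w i).transpose +
          betaMatrix β w i * (α w)⁻¹ * betaMatrix β w j) := by
    intro i j
    rw [add_mul, hd, Matrix.mul_assoc, h.connMatrix_mul hw, connMatrix, connMatrix]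
    noncomm_ring
  have hc := h.curvature_matrix hw i j
  have hmul : ((Matrix.of fun s p => pd (fun w => connMatrix α β w j s p) i w) +
      connMatrix α β w i * connMatrix α β w j) * α w =
      ((Matrix.of fun s p => pd (fun w => connMatrix α β w i s p) j w) +
      connMatrix α β w j * connMatrix α β w i) * α w := by
    rw [hS, hS, ← sub_eq_zero]
    rw [sub_eq_iff_eq_add] at hc
    rw [hc]
    abel
  have := congrArg (fun M => M * (α w)⁻¹) hmul
  simpa only [Matrix.mul_assoc, Matrix.mul_nonsing_inv _ hu, Matrix.mul_one] using this

end IsFlatBracket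

end Microscopic


/-! ### Existence of flat coordinates -/

section FlatCoordinates

variable {m : ℕ} {V W : Set (Fin m → ℝ)} {α : (Fin m → ℝ) → Matrix (Fin m) (Fin m) ℝ}
  {β : (Fin m → ℝ) → Fin m → Fin m → Fin m → ℝ}

/-- The right hand side of the linear system `∂_j ν = a θ_j`, `∂_j θ_p = Γ_jrp θ_r` for a function
`ν` and a covector field `θ`. -/
noncomputable def flatSystem (a : ℝ) (Γ : Fin m → Fin m → Fin m → ℝ) (h : Fin m → ℝ)
    (y : ℝ × (Fin m → ℝ)) : ℝ × (Fin m → ℝ) :=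
  coeffSystem (κ := Fin m ⊕ (Fin m × Fin m × Fin m))
    (Sum.elim (fun j => ContinuousLinearMap.proj j) fun t => ContinuousLinearMap.proj t.1)
    (Sum.elim
      (fun j => (ContinuousLinearMap.proj j).comp (ContinuousLinearMap.snd ℝ ℝ (Fin m → ℝ)))
      fun t => (ContinuousLinearMap.proj t.2.1).comp (ContinuousLinearMap.snd ℝ ℝ (Fin m → ℝ)))
    (Sum.elim (fun _ => (1, 0)) fun t => (0, Pi.single t.2.2 1))
    (Sum.elim (fun _ => a) fun t => Γ t.1 t.2.1 t.2.2) h y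

theorem flatSystem_apply (a : ℝ) (Γ : Fin m → Fin m → Fin m → ℝ) (h : Fin m → ℝ)
    (y : ℝ × (Fin m → ℝ)) : flatSystem a Γ h y =
      (a * ∑ j, h j * y.2 j, fun p => ∑ j, ∑ r, Γ j r p * (h j * y.2 r)) := by
  ext i
  · simp [flatSystem, coeffSystem, Prod.fst_sum, Finset.mul_sum]
  · simp only [flatSystem, coeffSystem, Fintype.sum_sum_type, Fintype.sum_prod_type,
      Prod.snd_add, Prod.snd_sum, Pi.add_apply, Finset.sum_apply, Sum.elim_inl, Sum.elim_inr]
    rw [Finset.sum_eq_zero (by simp), zero_add]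
    refine Finset.sum_congr rfl fun j _ => Finset.sum_congr rfl fun r _ => ?_
    rw [Finset.sum_eq_single i]
    · simp
    · intro p _ hp
      simp [hp.symm]
    · simp

theorem jacobian_apply (ν : (Fin m → ℝ) → Fin m → ℝ) (w : Fin m → ℝ) (k p : Fin m) :
    jacobian ν w k p = pd (fun w => ν w k) p w := rfl

variable {ν : (Fin m → ℝ) → Fin m → ℝ} {g : Matrix (Fin m) (Fin m) ℝ}

theorem IsFlatCoord.contDiffOn_jacobian (hV : IsOpen V)
    (hν : IsFlatCoord α V ν g) (k p : Fin m) :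
    ContDiffOn ℝ ∞ (fun w => jacobian ν w k p) V :=
  ((contDiffOn_pi.1 hν.smooth k).fderiv_of_isOpen (m := ∞) hV (by simp)).clm_apply
    contDiffOn_const

theorem pd_pd_comm {F : (Fin m → ℝ) → ℝ} (hV : IsOpen V)
    (hF : ContDiffOn ℝ ∞ F V) {w : Fin m → ℝ} (hw : w ∈ V) (i j : Fin m) :
    pd (pd F i) j w = pd (pd F j) i w := by
  have hF' : DifferentiableAt ℝ (fderiv ℝ F) w :=
    ((hF.fderiv_of_isOpen (m := ∞) hV (by simp)).contDiffAt (hV.mem_nhds hw)).differentiableAt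
      (by simp)
  have e : ∀ i j, pd (pd F i) j w = fderiv ℝ (fderiv ℝ F) w (Pi.single j 1) (Pi.single i 1) := by
    intro i j
    have h1 : HasFDerivAt (pd F i) _ w := hF'.hasFDerivAt.clm_apply (hasFDerivAt_const _ w)
    rw [pd, h1.fderiv]
    simp
  rw [e, e]
  exact ((hF.contDiffAt (hV.mem_nhds hw)).isSymmSndFDerivAt
    (by rw [minSmoothness_of_isRCLikeNormedField]; exact WithTop.coe_le_coe.2 le_top)).eq _ _

namespace IsFlatBracket

variable (h : IsFlatBracket α β W)
include h

/-- The `ν`-component is symmetric in `a, b` by `connMatrix_symm`, the `θ`-component by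
`connMatrix_integrable`. The system with first coefficient `0` is the derivative of the one with
constant coefficient `1`. -/
theorem flatSystem_integrable {w : Fin m → ℝ} (hw : w ∈ W) (a b : Fin m → ℝ)
    (y : ℝ × (Fin m → ℝ)) :
    flatSystem 0 (fun j r p => fderiv ℝ (fun w => connMatrix α β w j r p) w a) b y +
      flatSystem 1 (fun j r p => connMatrix α β w j r p) b
        (flatSystem 1 (fun j r p => connMatrix α β w j r p) a y) =
    flatSystem 0 (fun j r p => fderiv ℝ (fun w => connMatrix α β w j r p) w b) a y +
      flatSystem 1 (fun j r p => connMatrix α β w j r p) a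
        (flatSystem 1 (fun j r p => connMatrix α β w j r p) b y) := by
  have key : ∀ a b : Fin m → ℝ,
      (∑ p, b p * ∑ j, ∑ r, connMatrix α β w j r p * (a j * y.2 r)) =
      ∑ p, ∑ j, ∑ r, connMatrix α β w j r p * (a j * b p * y.2 r) := by
    intro a b
    refine Finset.sum_congr rfl fun p _ => ?_
    rw [Finset.mul_sum]
    refine Finset.sum_congr rfl fun j _ => ?_
    rw [Finset.mul_sum]
    exact Finset.sum_congr rfl fun r _ => by ring
  have key2 : ∀ (a b : Fin m → ℝ) (p : Fin m),
      (∑ j, ∑ r, fderiv ℝ (fun w => connMatrix α β w j r p) w a * (b j * y.2 r)) +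
      (∑ j, ∑ r, connMatrix α β w j r p *
        (b j * ∑ i, ∑ s, connMatrix α β w i s r * (a i * y.2 s))) =
      ∑ i, ∑ j, ∑ s, a i * b j * y.2 s *
        ((Matrix.of fun s p => pd (fun w => connMatrix α β w j s p) i w) +
          connMatrix α β w i * connMatrix α β w j) s p := by
    intro a b p
    have e1 : (∑ j, ∑ r, fderiv ℝ (fun w => connMatrix α β w j r p) w a * (b j * y.2 r)) =
        ∑ i, ∑ j, ∑ s, a i * b j * y.2 s * pd (fun w => connMatrix α β w j s p) i w := by
      have : ∀ j r, fderiv ℝ (fun w => connMatrix α β w j r p) w a * (b j * y.2 r) =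
          ∑ i, a i * b j * y.2 r * pd (fun w => connMatrix α β w j r p) i w := fun j r => by
        rw [clm_apply_eq_sum, Finset.sum_mul]
        exact Finset.sum_congr rfl fun i _ => by ring
      simp only [this]
      rw [Finset.sum_comm (f := fun i j => ∑ s, a i * b j * y.2 s *
        pd (fun w => connMatrix α β w j s p) i w)]
      exact Finset.sum_congr rfl fun j _ => Finset.sum_comm
    have e2 : (∑ j, ∑ r, connMatrix α β w j r p *
        (b j * ∑ i, ∑ s, connMatrix α β w i s r * (a i * y.2 s))) =
        ∑ i, ∑ j, ∑ s, a i * b j * y.2 s * (connMatrix α β w i * connMatrix α β w j) s p := by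
      simp only [Matrix.mul_apply, Finset.mul_sum]
      rw [Finset.sum_comm (f := fun i j => ∑ s, ∑ r, a i * b j * y.2 s *
        (connMatrix α β w i s r * connMatrix α β w j r p))]
      refine Finset.sum_congr rfl fun j _ => ?_
      rw [Finset.sum_comm]
      refine Finset.sum_congr rfl fun i _ => ?_
      rw [Finset.sum_comm]
      exact Finset.sum_congr rfl fun s _ => Finset.sum_congr rfl fun r _ => by ring
    rw [e1, e2, ← Finset.sum_add_distrib]
    refine Finset.sum_congr rfl fun i _ => ?_
    rw [← Finset.sum_add_distrib]
    refine Finset.sum_congr rfl fun j _ => ?_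
    rw [← Finset.sum_add_distrib]
    refine Finset.sum_congr rfl fun s _ => ?_
    rw [Matrix.add_apply, Matrix.of_apply]
    ring
  simp only [flatSystem_apply]
  refine Prod.ext ?_ (funext fun p => ?_)
  · simp only [Prod.fst_add, zero_mul, zero_add, one_mul]
    rw [key, key, Finset.sum_comm]
    refine Finset.sum_congr rfl fun p _ => Finset.sum_congr rfl fun j _ =>
      Finset.sum_congr rfl fun r _ => ?_
    rw [h.connMatrix_symm hw]
    ring
  · simp only [Prod.snd_add, Pi.add_apply]
    rw [key2, key2, Finset.sum_comm]
    refine Finset.sum_congr rfl fun i _ => Finset.sum_congr rfl fun j _ =>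
      Finset.sum_congr rfl fun s _ => ?_
    rw [h.connMatrix_integrable hw]
    ring

/-- Scalar products of parallel covector fields are locally constant. -/
theorem pd_metric_eq_zero {w : Fin m → ℝ} (hw : w ∈ W) {θ η : (Fin m → ℝ) → Fin m → ℝ}
    (hθ : ∀ p, DifferentiableAt ℝ (fun w => θ w p) w)
    (hη : ∀ p, DifferentiableAt ℝ (fun w => η w p) w)
    (hθ' : ∀ p j, pd (fun w => θ w p) j w = ∑ r, connMatrix α β w j r p * θ w r)
    (hη' : ∀ p j, pd (fun w => η w p) j w = ∑ r, connMatrix α β w j r p * η w r) :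
    HasFDerivAt (fun w => ∑ p, ∑ q, θ w p * α w p q * η w q) (0 : (Fin m → ℝ) →L[ℝ] ℝ) w := by
  have h1 := HasFDerivAt.fun_sum (u := Finset.univ) fun p _ =>
    HasFDerivAt.fun_sum (u := Finset.univ) fun q _ =>
      ((hθ p).hasFDerivAt.mul (h.differentiableAt_alpha hw p q).hasFDerivAt).mul
        (hη q).hasFDerivAt
  refine h1.congr_fderiv ?_
  refine ContinuousLinearMap.ext fun v => ?_
  rw [clm_apply_eq_sum, zero_apply]
  refine Finset.sum_eq_zero fun j _ => mul_eq_zero_of_left ?_ _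
  have hm := h.connMatrix_mul hw j
  have t1 : ∑ p, ∑ q, pd (fun w => θ w p) j w * α w p q * η w q =
      -∑ p, ∑ q, θ w p * β w p q j * η w q := by
    have : ∀ r q, ∑ p, connMatrix α β w j r p * α w p q = -β w r q j := fun r q => by
      have := congrFun (congrFun hm r) q
      rwa [Matrix.mul_apply] at this
    rw [Finset.sum_comm]
    rw [Finset.sum_comm (f := fun p q => θ w p * β w p q j * η w q), ← Finset.sum_neg_distrib]
    refine Finset.sum_congr rfl fun q _ => ?_
    rw [← Finset.sum_mul, ← Finset.sum_mul, ← neg_mul]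
    congr 1
    simp only [hθ', Finset.sum_mul]
    rw [Finset.sum_comm, ← Finset.sum_neg_distrib]
    refine Finset.sum_congr rfl fun r _ => ?_
    rw [← mul_neg, ← this r q, Finset.mul_sum]
    exact Finset.sum_congr rfl fun p _ => by ring
  have t2 : ∑ p, ∑ q, θ w p * α w p q * pd (fun w => η w q) j w =
      -∑ p, ∑ q, θ w p * β w q p j * η w q := by
    have : ∀ r p, ∑ q, connMatrix α β w j r q * α w p q = -β w r p j := fun r p => by
      have := congrFun (congrFun hm r) p
      rw [Matrix.mul_apply] at this
      refine Eq.trans (Finset.sum_congr rfl fun q _ => ?_) this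
      rw [(h.isSymm w hw).apply]
    rw [← Finset.sum_neg_distrib]
    refine Finset.sum_congr rfl fun p _ => ?_
    simp only [hη', Finset.mul_sum]
    rw [Finset.sum_comm, ← Finset.sum_neg_distrib]
    refine Finset.sum_congr rfl fun r _ => ?_
    rw [← neg_mul, ← mul_neg, ← this r p, Finset.mul_sum, Finset.sum_mul]
    exact Finset.sum_congr rfl fun q _ => by ring
  simp only [sum_apply, add_apply, smul_apply, smul_eq_mul]
  -- Compatibility splits `∂_j α` into `β_j + β_jᵗ`; the two parts cancel against the derivatives of
  -- `θ` and `η`, which `Γ_j α = -β_j` expresses through `β`.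
  have t3 : ∀ p q, θ w p * α w p q * pd (fun w => η w q) j w +
      η w q * (θ w p * pd (fun w => α w p q) j w + α w p q * pd (fun w => θ w p) j w) =
      θ w p * α w p q * pd (fun w => η w q) j w +
      (θ w p * β w p q j * η w q + θ w p * β w q p j * η w q) +
      pd (fun w => θ w p) j w * α w p q * η w q := by
    intro p q
    rw [← h.compatible w hw]
    ring
  refine Eq.trans (Finset.sum_congr rfl fun p _ => Finset.sum_congr rfl fun q _ => t3 p q) ?_
  simp only [Finset.sum_add_distrib, t1, t2]
  ring

/-- Flat coordinates exist around every point. -/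
theorem exists_isFlatCoord {w₀ : Fin m → ℝ} (hw₀ : w₀ ∈ W) :
    ∃ (V : Set (Fin m → ℝ)) (ν : (Fin m → ℝ) → Fin m → ℝ) (g : Matrix (Fin m) (Fin m) ℝ),
      IsOpen V ∧ w₀ ∈ V ∧ V ⊆ W ∧ Set.InjOn ν V ∧ IsFlatCoord α V ν g := by
  obtain ⟨r, hr, hrW, hex⟩ := exists_solution_coeffSystem
    (κ := Fin m ⊕ (Fin m × Fin m × Fin m))
    (u := Sum.elim (fun j => ContinuousLinearMap.proj j) fun t => ContinuousLinearMap.proj t.1)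
    (φ := Sum.elim
      (fun j => (ContinuousLinearMap.proj j).comp (ContinuousLinearMap.snd ℝ ℝ (Fin m → ℝ)))
      fun t => (ContinuousLinearMap.proj t.2.1).comp (ContinuousLinearMap.snd ℝ ℝ (Fin m → ℝ)))
    (e := Sum.elim (fun _ => (1, 0)) fun t => (0, Pi.single t.2.2 1))
    (c := fun w => Sum.elim (fun _ => 1) fun t => connMatrix α β w t.1 t.2.1 t.2.2) h.isOpen
    (by
      rintro (j | t)
      · exact contDiffOn_const
      · exact h.contDiffOn_conn _ _ _)
    (fun w hw a b y => by
      have hd : ∀ a : Fin m → ℝ, (fun t => fderiv ℝ (fun w => Sum.elim (fun _ : Fin m => (1 : ℝ))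
          (fun t : Fin m × Fin m × Fin m => connMatrix α β w t.1 t.2.1 t.2.2) t) w a) =
          Sum.elim (fun _ => 0) fun t => fderiv ℝ (fun w => connMatrix α β w t.1 t.2.1 t.2.2) w a :=
        fun a => funext fun t => by
          rcases t with j | t
          · simp
          · rfl
      rw [hd, hd]
      exact h.flatSystem_integrable hw a b y) hw₀
  -- The `k`-th solution starts with `ν_k = 0` and `dν_k = e_k`, so the Jacobian matrix at `w₀` is
  -- the identity and the constant metric is `α w₀`.
  choose Y hY0 hYs hYL using fun k : Fin m => hex (0, Pi.single k 1)
  have hY : ∀ k, ∀ w ∈ Metric.ball w₀ r, ∃ L : (Fin m → ℝ) →L[ℝ] ℝ × (Fin m → ℝ),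
      HasFDerivAt (Y k) L w ∧ ∀ a, L a =
        (∑ j, a j * (Y k w).2 j, fun p => ∑ j, ∑ r, connMatrix α β w j r p *
          (a j * (Y k w).2 r)) := by
    intro k w hw
    obtain ⟨L, hL, hLa⟩ := hYL k w hw
    refine ⟨L, hL, fun a => (hLa a).trans ?_⟩
    exact (flatSystem_apply 1 (fun j r p => connMatrix α β w j r p) a (Y k w)).trans
      (by rw [one_mul])
  have hw₀r : w₀ ∈ Metric.ball w₀ r := Metric.mem_ball_self hr
  set ν : (Fin m → ℝ) → Fin m → ℝ := fun w k => (Y k w).1 with hν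
  have hνs : ContDiffOn ℝ ∞ ν (Metric.ball w₀ r) := contDiffOn_pi.2 fun k => (hYs k).fst
  have hd1 : ∀ k, ∀ w ∈ Metric.ball w₀ r, ∀ j, pd (fun w => (Y k w).1) j w = (Y k w).2 j := by
    intro k w hw j
    obtain ⟨L, hL, hLa⟩ := hY k w hw
    rw [pd, hL.fst.fderiv]
    simp [hLa, Pi.single_apply]
  have hd2 : ∀ k, ∀ w ∈ Metric.ball w₀ r, ∀ p j, pd (fun w => (Y k w).2 p) j w =
      ∑ r, connMatrix α β w j r p * (Y k w).2 r := by
    intro k w hw p j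
    obtain ⟨L, hL, hLa⟩ := hY k w hw
    have h1 := hasFDerivAt_pi'.1 hL.snd p
    rw [pd, h1.fderiv]
    simp [hLa, Pi.single_apply]
  have hdiff : ∀ k, ∀ w ∈ Metric.ball w₀ r, ∀ p,
      DifferentiableAt ℝ (fun w => (Y k w).2 p) w := fun k w hw p => by
    obtain ⟨L, hL, -⟩ := hY k w hw
    exact (hasFDerivAt_pi'.1 hL.snd p).differentiableAt
  have hJ : ∀ w ∈ Metric.ball w₀ r, ∀ k p, jacobian ν w k p = (Y k w).2 p := fun w hw k p =>
    hd1 k w hw p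
  have hflat : ∀ w ∈ Metric.ball w₀ r, jacobian ν w * α w * (jacobian ν w).transpose = α w₀ := by
    intro w hw
    ext k l
    have hc : (∑ p, ∑ q, (Y k w).2 p * α w p q * (Y l w).2 q) =
        ∑ p, ∑ q, (Y k w₀).2 p * α w₀ p q * (Y l w₀).2 q :=
      Metric.isOpen_ball.is_const_of_fderiv_eq_zero (convex_ball w₀ r).isPreconnected
        (fun w hw => (h.pd_metric_eq_zero (hrW hw) (hdiff k w hw) (hdiff l w hw) (hd2 k w hw)
          (hd2 l w hw)).differentiableAt.differentiableWithinAt)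
        (fun w hw => (h.pd_metric_eq_zero (hrW hw) (hdiff k w hw) (hdiff l w hw) (hd2 k w hw)
          (hd2 l w hw)).fderiv) hw hw₀r
    have h0 : (∑ p, ∑ q, (Y k w₀).2 p * α w₀ p q * (Y l w₀).2 q) = α w₀ k l := by
      rw [hY0, hY0]
      simp [Pi.single_apply]
    rw [← h0, ← hc, Matrix.mul_apply, Finset.sum_comm]
    refine Finset.sum_congr rfl fun q _ => ?_
    rw [Matrix.mul_apply, Finset.sum_mul]
    refine Finset.sum_congr rfl fun p _ => ?_
    rw [Matrix.transpose_apply, hJ w hw, hJ w hw]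
  have hν0 : HasFDerivAt ν (ContinuousLinearEquiv.refl ℝ (Fin m → ℝ) :
      (Fin m → ℝ) →L[ℝ] (Fin m → ℝ)) w₀ := by
    refine hasFDerivAt_pi'.2 fun k => ?_
    obtain ⟨L, hL, hLa⟩ := hY k w₀ hw₀r
    refine hL.fst.congr_fderiv (ContinuousLinearMap.ext fun v => ?_)
    simp [hLa, hY0, Pi.single_apply]
  have hstrict := (hνs.contDiffAt (Metric.isOpen_ball.mem_nhds hw₀r)).hasStrictFDerivAt'
    hν0 (by simp)
  set e := hstrict.toOpenPartialHomeomorph ν with he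
  refine ⟨Metric.ball w₀ r ∩ e.source, ν, α w₀, Metric.isOpen_ball.inter e.open_source,
    ⟨hw₀r, hstrict.mem_toOpenPartialHomeomorph_source⟩, fun w hw => hrW hw.1,
    fun a ha b hb hab => e.injOn ha.2 hb.2 hab, ?_⟩
  -- Invertibility of `J` on the whole neighbourhood follows from `J α Jᵗ = α w₀`: a singular `J`
  -- would make `α w₀` singular.
  refine ⟨hνs.mono Set.inter_subset_left, fun w hw h0 => h.det_ne_zero w₀ hw₀ ?_,
    h.isSymm w₀ hw₀, h.det_ne_zero w₀ hw₀, fun w hw => hflat w hw.1⟩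
  rw [← hflat w hw.1, Matrix.det_mul, Matrix.det_mul, h0, zero_mul, zero_mul]

/-! ### Flat coordinates trivialize the connection -/

/-- Differentiate the constant `J α Jᵗ = g` and use compatibility: the result is the transformed `β`
plus its transpose. -/
theorem transformedBeta_antisymm (hV : IsOpen V) (hVW : V ⊆ W) (hν : IsFlatCoord α V ν g)
    {w : Fin m → ℝ} (hw : w ∈ V) (k l j : Fin m) :
    transformedBeta α β ν w k l j = -transformedBeta α β ν w l k j := by
  have hJ : ∀ k p, DifferentiableAt ℝ (fun w => jacobian ν w k p) w := fun k p =>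
    ((hν.contDiffOn_jacobian hV k p).contDiffAt (hV.mem_nhds hw)).differentiableAt (by simp)
  have h1 := HasFDerivAt.fun_sum (u := Finset.univ) fun p _ =>
    HasFDerivAt.fun_sum (u := Finset.univ) fun q _ =>
      ((hJ k p).hasFDerivAt.fun_mul (h.differentiableAt_alpha (hVW hw) p q).hasFDerivAt).fun_mul
        (hJ l q).hasFDerivAt
  have h2 : (fun w => ∑ p, ∑ q, jacobian ν w k p * α w p q * jacobian ν w l q) =ᶠ[nhds w]
      fun _ => g k l := by
    filter_upwards [hV.mem_nhds hw] with w hw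
    rw [← hν.flat w hw, Matrix.mul_apply, Finset.sum_comm]
    refine Finset.sum_congr rfl fun q _ => ?_
    rw [Matrix.mul_apply, Finset.sum_mul]
    rfl
  have h3 := congrArg (fun L : (Fin m → ℝ) →L[ℝ] ℝ => L (Pi.single j 1))
    (h1.unique ((hasFDerivAt_const (g k l) w).congr_of_eventuallyEq h2))
  simp only [sum_apply, add_apply, smul_apply, smul_eq_mul, zero_apply] at h3
  rw [eq_neg_iff_add_eq_zero, ← h3, transformedBeta, transformedBeta,
    Finset.sum_comm (f := fun p q => fderiv ℝ (fun w' => jacobian ν w' l p) w (Pi.single j 1) *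
      α w p q * jacobian ν w k q + jacobian ν w l p * β w p q j * jacobian ν w k q),
    ← Finset.sum_add_distrib]
  refine Finset.sum_congr rfl fun p _ => ?_
  rw [← Finset.sum_add_distrib]
  refine Finset.sum_congr rfl fun q _ => ?_
  rw [(h.isSymm w (hVW hw)).apply p q]
  linear_combination (jacobian ν w k p * jacobian ν w l q) * h.compatible w (hVW hw) p q j

/-- With the last index raised by `α Jᵗ`, the first part of the transformed `β` is the Hessian of
`ν_k` in two slots, symmetric by equality of mixed derivatives. The second is symmetric by vanishing
torsion. -/
theorem transformedBeta_symm (hV : IsOpen V) (hVW : V ⊆ W) (hν : IsFlatCoord α V ν g)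
    {w : Fin m → ℝ} (hw : w ∈ V) (k l i : Fin m) :
    ∑ j, transformedBeta α β ν w k l j * (α w * (jacobian ν w).transpose) j i =
      ∑ j, transformedBeta α β ν w k i j * (α w * (jacobian ν w).transpose) j l := by
  have hS := h.isSymm w (hVW hw)
  have key : ∀ l i, ∑ j, transformedBeta α β ν w k l j * (α w * (jacobian ν w).transpose) j i =
      (∑ j, ∑ p, pd (pd (fun w => ν w k) p) j w * (α w * (jacobian ν w).transpose) p l *
        (α w * (jacobian ν w).transpose) j i) +
      ∑ p, ∑ q, ∑ n, jacobian ν w k p * jacobian ν w l q * jacobian ν w i n *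
        ∑ j, α w n j * β w p q j := by
    intro l i
    simp only [transformedBeta, Finset.sum_add_distrib, add_mul]
    congr 1
    · refine Finset.sum_congr rfl fun j _ => ?_
      refine (Finset.sum_mul _ _ _).trans (Finset.sum_congr rfl fun p _ => ?_)
      congr 1
      rw [Matrix.mul_apply, Finset.mul_sum]
      refine Finset.sum_congr rfl fun q _ => ?_
      rw [Matrix.transpose_apply, mul_assoc]
      rfl
    · have e : ∀ p q, (∑ n, jacobian ν w k p * jacobian ν w l q * jacobian ν w i n *
          ∑ j, α w n j * β w p q j) = ∑ j, jacobian ν w k p * β w p q j * jacobian ν w l q *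
            (α w * (jacobian ν w).transpose) j i := by
        intro p q
        simp only [Matrix.mul_apply, Matrix.transpose_apply, Finset.mul_sum]
        rw [Finset.sum_comm]
        refine Finset.sum_congr rfl fun j _ => Finset.sum_congr rfl fun n _ => ?_
        rw [hS.apply]
        ring
      simp only [e, Finset.sum_mul]
      rw [Finset.sum_comm]
      exact Finset.sum_congr rfl fun p _ => Finset.sum_comm
  rw [key, key]
  congr 1
  · rw [Finset.sum_comm]
    refine Finset.sum_congr rfl fun p _ => Finset.sum_congr rfl fun j _ => ?_
    rw [pd_pd_comm hV (contDiffOn_pi.1 hν.smooth k) hw]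
    ring
  · refine Finset.sum_congr rfl fun p _ => ?_
    rw [Finset.sum_comm]
    refine Finset.sum_congr rfl fun q _ => Finset.sum_congr rfl fun n _ => ?_
    rw [h.torsion w (hVW hw)]
    ring

/-- In flat coordinates the `β`-part of the microscopic bracket vanishes. -/
theorem transformedBeta_eq_zero (hV : IsOpen V) (hVW : V ⊆ W) (hν : IsFlatCoord α V ν g)
    {w : Fin m → ℝ} (hw : w ∈ V) (k l j : Fin m) : transformedBeta α β ν w k l j = 0 := by
  have h0 : ∀ k l i,
      ∑ j, transformedBeta α β ν w k l j * (α w * (jacobian ν w).transpose) j i = 0 := by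
    set B : Fin m → Fin m → Fin m → ℝ := fun k l i =>
      ∑ j, transformedBeta α β ν w k l j * (α w * (jacobian ν w).transpose) j i
    have hs : ∀ k l i, B k l i = B k i l := h.transformedBeta_symm hV hVW hν hw
    have ha : ∀ k l i, B k l i = -B l k i := by
      intro k l i
      simp only [B, ← Finset.sum_neg_distrib, ← neg_mul]
      exact Finset.sum_congr rfl fun j _ => by
        rw [h.transformedBeta_antisymm hV hVW hν hw k l j]
    intro k l i
    -- Six alternating transpositions return to the same index triple with the opposite sign.
    have e1 := ha k l i
    have e2 := hs l k i
    have e3 := ha l i k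
    have e4 := hs i l k
    have e5 := ha i k l
    have e6 := hs k i l
    change B k l i = 0
    linarith
  have hdet : (α w * (jacobian ν w).transpose).det ≠ 0 := by
    rw [Matrix.det_mul, Matrix.det_transpose]
    exact mul_ne_zero (h.det_ne_zero w (hVW hw)) (hν.invertible w hw)
  exact congrFun (Matrix.eq_zero_of_vecMul_eq_zero hdet
    (v := fun j => transformedBeta α β ν w k l j) (funext fun i => h0 k l i)) j

/-- Cancelling the invertible factor `J` on the second index of the vanishing transformed `β` leaves
the Casimir condition for `R = ν_k` and `ε = 0`. -/
theorem hessian_flatCoord (hV : IsOpen V) (hVW : V ⊆ W) (hν : IsFlatCoord α V ν g)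
    {w : Fin m → ℝ} (hw : w ∈ V) (k q j : Fin m) :
    ∑ p, (pd (pd (fun w => ν w k) p) j w * α w p q + jacobian ν w k p * β w p q j) = 0 := by
  refine congrFun (Matrix.eq_zero_of_mulVec_eq_zero (hν.invertible w hw)
    (v := fun q => ∑ p, (pd (pd (fun w => ν w k) p) j w * α w p q + jacobian ν w k p * β w p q j))
    (funext fun l => ?_)) q
  rw [Pi.zero_apply, ← h.transformedBeta_eq_zero hV hVW hν hw k l j, transformedBeta,
    Finset.sum_comm, Matrix.mulVec, dotProduct]
  refine Finset.sum_congr rfl fun q _ => ?_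
  rw [mul_comm, Finset.sum_mul]
  exact Finset.sum_congr rfl fun p _ => add_mul _ _ _

end IsFlatBracket

end FlatCoordinates


/-! ### Casimir invariants -/

section Casimirs

variable {m : ℕ} {V W : Set (Fin m → ℝ)} {α : (Fin m → ℝ) → Matrix (Fin m) (Fin m) ℝ}
  {β : (Fin m → ℝ) → Fin m → Fin m → Fin m → ℝ}

/-- The density `ε u + ρ R(w)`. -/
def affineDensity (ε : ℝ) (R : (Fin m → ℝ) → ℝ) : Density (Fin 2 ⊕ Fin m) :=
  fun _ z => ε * z 0 iu + z 0 iρ * R (wval z)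

theorem isDiffFun_affineDensity (ε : ℝ) {R : (Fin m → ℝ) → ℝ} (hR : ContDiffOn ℝ ∞ R V) :
    IsDiffFun (fieldDomain V) (affineDensity ε R) :=
  ((IsDiffFun.const ε).mul (IsDiffFun.coord 0 iu)).add
    ((IsDiffFun.coord 0 iρ).mul (isDiffFun_comp_wval hR))

theorem varDeriv_iρ_affineDensity (hV : IsOpen V) (ε : ℝ) (R : (Fin m → ℝ) → ℝ) {x : ℝ}
    {z : Jet (Fin 2 ⊕ Fin m)} (hz : z 0 ∈ fieldDomain V) :
    varDeriv iρ (affineDensity ε R) x z = R (wval z) := by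
  refine varDeriv_zeroth (φ := fun p => ε * p.2 iu + p.2 iρ * R fun k => p.2 (iw k))
    (isOpen_fieldDomain hV) iρ hz ?_
  have h := (((hasDerivAt_id (0 : ℝ)).const_add (z 0 iρ)).mul_const (R (wval z))).const_add
    (ε * z 0 iu)
  have hw : (fun k => z 0 (iw k)) = wval z := rfl
  simpa [hw] using h

theorem varDeriv_iu_affineDensity (hV : IsOpen V) (ε : ℝ) (R : (Fin m → ℝ) → ℝ) {x : ℝ}
    {z : Jet (Fin 2 ⊕ Fin m)} (hz : z 0 ∈ fieldDomain V) :
    varDeriv iu (affineDensity ε R) x z = ε := by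
  refine varDeriv_zeroth (φ := fun p => ε * p.2 iu + p.2 iρ * R fun k => p.2 (iw k))
    (isOpen_fieldDomain hV) iu hz ?_
  have h := (((hasDerivAt_id (0 : ℝ)).const_add (z 0 iu)).const_mul ε).add_const
    (z 0 iρ * R (wval z))
  have hw : (fun k => z 0 (iw k)) = wval z := rfl
  simpa [hw] using h

theorem varDeriv_iw_affineDensity (hV : IsOpen V) (ε : ℝ) {R : (Fin m → ℝ) → ℝ}
    (hR : ContDiffOn ℝ ∞ R V) (k : Fin m) {x : ℝ}
    {z : Jet (Fin 2 ⊕ Fin m)} (hz : z 0 ∈ fieldDomain V) :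
    varDeriv (iw k) (affineDensity ε R) x z = z 0 iρ * pd R k (wval z) := by
  refine varDeriv_zeroth (φ := fun p => ε * p.2 iu + p.2 iρ * R fun k => p.2 (iw k))
    (isOpen_fieldDomain hV) (iw k) hz ?_
  have h := ((hasDerivAt_update_line (((hR.contDiffAt (hV.mem_nhds hz.2)).differentiableAt
    (by simp))) k).const_mul (z 0 iρ)).const_add (ε * z 0 iu)
  have hline : ∀ t : ℝ, (fun p : Fin m =>
      (z 0 + t • Pi.single (iw k) 1 : Fin 2 ⊕ Fin m → ℝ) (iw p)) =
      wval z + t • Pi.single k 1 := by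
    intro t
    funext p
    simp [wval, Pi.single_apply]
  have hw : (fun k => z 0 (iw k)) = wval z := rfl
  simp only [hline]
  simpa [hw] using h

theorem contDiffOn_pd (hV : IsOpen V) {R : (Fin m → ℝ) → ℝ} (hR : ContDiffOn ℝ ∞ R V)
    (k : Fin m) : ContDiffOn ℝ ∞ (pd R k) V :=
  (hR.fderiv_of_isOpen (m := ∞) hV (by simp)).clm_apply contDiffOn_const

/-- The condition on `R` for `∫ ε u + ρ R(w) dx` to be a Casimir invariant. -/
theorem isCasimir_affineDensity (hV : IsOpen V) (ε : ℝ) {R : (Fin m → ℝ) → ℝ}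
    (hR : ContDiffOn ℝ ∞ R V)
    (hRβ : ∀ w ∈ V, ∀ l j, (∑ k, (pd (pd R k) j w * α w k l + pd R k w * β w k l j)) =
      if j = l then -ε else 0) :
    IsCasimir (fieldDomain V) (decBracket α β) (affineDensity ε R) := by
  have hΩ := isOpen_fieldDomain hV
  refine ⟨isDiffFun_affineDensity ε hR, fun f hf => ?_⟩
  have hfu := hf.varDeriv hΩ iu
  -- Here `F_u = ε`, `F_ρ = R` and `F_k/ρ = ∂_k R`. The terms with `f_u` combine to `-∂ₓ(R f_u)`;
  -- the condition on `R` makes the terms with the `w`-derivatives of `f` cancel.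
  refine ⟨fun x z => -(R (wval z) * varDeriv iu f x z), ((isDiffFun_comp_wval hR).mul hfu).neg,
    fun x z hz => ?_⟩
  have hρ : z 0 iρ ≠ 0 := hz.1.ne'
  have h1 : totalDeriv (varDeriv iu (affineDensity ε R)) x z = 0 := by
    rw [totalDeriv_congr (g := fun _ _ => ε) hΩ
      (fun x z hz => varDeriv_iu_affineDensity hV ε R hz) hz]
    exact (totalDeriv_position hV contDiff_const hz).trans (by simp)
  have h2 : ∀ x z, z 0 ∈ fieldDomain V → ∀ k,
      varDeriv (iw k) (affineDensity ε R) x z / z 0 iρ = pd R k (wval z) := by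
    intro x z hz k
    rw [varDeriv_iw_affineDensity hV ε hR k hz, mul_div_cancel_left₀ _ hz.1.ne']
  have h3 : ∀ k, totalDeriv (fun x z => varDeriv (iw k) (affineDensity ε R) x z / z 0 iρ) x z =
      ∑ j, pd (pd R k) j (wval z) * z 1 (iw j) := by
    intro k
    rw [totalDeriv_congr hΩ (fun x z hz => h2 x z hz k) hz]
    exact totalDeriv_comp_wval hV (contDiffOn_pd hV hR k) hz
  rw [totalDeriv_neg hΩ ((isDiffFun_comp_wval hR).mul hfu) hz,
    totalDeriv_mul hΩ (isDiffFun_comp_wval hR) hfu hz, totalDeriv_comp_wval hV hR hz]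
  simp only [decBracket, h1, h2 x z hz, h3, varDeriv_iu_affineDensity hV ε R hz,
    varDeriv_iρ_affineDensity hV ε R hz]
  have h4 : (∑ k, ∑ l, ((∑ j, pd (pd R k) j (wval z) * z 1 (iw j)) * α (wval z) k l *
      (varDeriv (iw l) f x z / z 0 iρ) + pd R k (wval z) *
        (∑ j, β (wval z) k l j * z 1 (iw j)) * (varDeriv (iw l) f x z / z 0 iρ))) =
      -∑ l, z 1 (iw l) * (ε * (varDeriv (iw l) f x z / z 0 iρ)) := by
    rw [Finset.sum_comm, ← Finset.sum_neg_distrib]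
    refine Finset.sum_congr rfl fun l _ => ?_
    have h5 : (∑ k, ((∑ j, pd (pd R k) j (wval z) * z 1 (iw j)) * α (wval z) k l +
        pd R k (wval z) * ∑ j, β (wval z) k l j * z 1 (iw j))) = -ε * z 1 (iw l) := by
      have h6 : (∑ j, (∑ k, (pd (pd R k) j (wval z) * α (wval z) k l +
          pd R k (wval z) * β (wval z) k l j)) * z 1 (iw j)) = -ε * z 1 (iw l) := by
        simp [hRβ (wval z) hz.2]
      rw [← h6]
      simp only [Finset.sum_mul, Finset.mul_sum, ← Finset.sum_add_distrib]
      rw [Finset.sum_comm]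
      exact Finset.sum_congr rfl fun j _ => Finset.sum_congr rfl fun k _ => by ring
    have h6 : -(z 1 (iw l) * (ε * (varDeriv (iw l) f x z / z 0 iρ))) =
        -ε * z 1 (iw l) * (varDeriv (iw l) f x z / z 0 iρ) := by ring
    rw [h6, ← h5, Finset.sum_mul]
    exact Finset.sum_congr rfl fun k _ => by ring
  rw [h4]
  simp only [mul_sub, Finset.sum_sub_distrib, Finset.sum_mul]
  have h7 : ∀ j, z 1 (iw j) * (pd R j (wval z) * varDeriv iu f x z) =
      pd R j (wval z) * z 1 (iw j) * varDeriv iu f x z := fun j => by ring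
  simp only [h7]
  ring

/-! ### The Casimir densities in the form `ε u + ρ R(w)` -/

theorem rhoDensity_eq : rhoDensity = affineDensity (m := m) 0 fun _ => 1 := by
  funext x z
  simp [rhoDensity, affineDensity]

theorem rhoNuDensity_eq (ν : (Fin m → ℝ) → Fin m → ℝ) (k : Fin m) :
    rhoNuDensity ν k = affineDensity 0 fun w => ν w k := by
  funext x z
  simp [rhoNuDensity, affineDensity]

/-- The potential `-½ ν·g⁻¹ν`. -/
noncomputable def flatPotential (ν : (Fin m → ℝ) → Fin m → ℝ) (g : Matrix (Fin m) (Fin m) ℝ)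
    (w : Fin m → ℝ) : ℝ := -(1 / 2) * ∑ k, ∑ l, ν w k * g⁻¹ k l * ν w l

theorem psiDensity_eq (ν : (Fin m → ℝ) → Fin m → ℝ) (g : Matrix (Fin m) (Fin m) ℝ) :
    psiDensity ν g = affineDensity 1 (flatPotential ν g) := by
  funext x z
  have : (∑ k, ∑ l, ν (wval z) k * g⁻¹ k l * ν (wval z) l) =
      ν (wval z) ⬝ᵥ g⁻¹.mulVec (ν (wval z)) := by
    simp only [dotProduct, Matrix.mulVec, Finset.mul_sum, mul_assoc]
  rw [psiDensity, affineDensity, flatPotential, this]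
  ring

variable {ν : (Fin m → ℝ) → Fin m → ℝ} {g : Matrix (Fin m) (Fin m) ℝ}

theorem IsFlatCoord.contDiffOn_flatPotential (hν : IsFlatCoord α V ν g) :
    ContDiffOn ℝ ∞ (flatPotential ν g) V := by
  have h := contDiffOn_pi.1 hν.smooth
  exact contDiffOn_const.mul (ContDiffOn.sum fun k _ => ContDiffOn.sum fun l _ =>
    ((h k).mul contDiffOn_const).mul (h l))

theorem IsFlatCoord.inv_symm (hν : IsFlatCoord α V ν g) (k l : Fin m) : g⁻¹ k l = g⁻¹ l k := by
  have h : (g⁻¹).transpose = g⁻¹ := by rw [Matrix.transpose_nonsing_inv, hν.symm]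
  rw [← congrFun (congrFun h l) k, Matrix.transpose_apply]

theorem IsFlatCoord.pd_flatPotential (hV : IsOpen V) (hν : IsFlatCoord α V ν g) {w : Fin m → ℝ}
    (hw : w ∈ V) (p : Fin m) :
    pd (flatPotential ν g) p w = -∑ k, ∑ l, g⁻¹ k l * ν w l * jacobian ν w k p := by
  have hd : ∀ k, HasFDerivAt (fun w => ν w k) (fderiv ℝ (fun w => ν w k) w) w := fun k =>
    (((contDiffOn_pi.1 hν.smooth k).contDiffAt (hV.mem_nhds hw)).differentiableAt
      (by simp)).hasFDerivAt
  have h1 : HasFDerivAt (flatPotential ν g) _ w :=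
    (HasFDerivAt.fun_sum (u := Finset.univ) fun k _ => HasFDerivAt.fun_sum (u := Finset.univ)
      fun l _ => ((hd k).mul_const (g⁻¹ k l)).fun_mul (hd l)).const_mul (-(1 / 2))
  rw [pd, h1.fderiv]
  simp only [smul_apply, sum_apply, add_apply, smul_eq_mul, Finset.sum_add_distrib]
  have e1 : (∑ k, ∑ l, ν w k * g⁻¹ k l * fderiv ℝ (fun w => ν w l) w (Pi.single p 1)) =
      ∑ k, ∑ l, g⁻¹ k l * ν w l * jacobian ν w k p := by
    rw [Finset.sum_comm]
    refine Finset.sum_congr rfl fun k _ => Finset.sum_congr rfl fun l _ => ?_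
    rw [hν.inv_symm l k, jacobian_apply]
    ring
  have e2 : (∑ k, ∑ l, ν w l * (g⁻¹ k l * fderiv ℝ (fun w => ν w k) w (Pi.single p 1))) =
      ∑ k, ∑ l, g⁻¹ k l * ν w l * jacobian ν w k p :=
    Finset.sum_congr rfl fun k _ => Finset.sum_congr rfl fun l _ => by
      rw [jacobian_apply]
      ring
  rw [e1, e2]
  ring

theorem IsFlatCoord.pd_pd_flatPotential (hV : IsOpen V) (hν : IsFlatCoord α V ν g)
    {w : Fin m → ℝ} (hw : w ∈ V) (p j : Fin m) :
    pd (pd (flatPotential ν g) p) j w =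
      -∑ k, ∑ l, (g⁻¹ k l * jacobian ν w l j * jacobian ν w k p +
        g⁻¹ k l * ν w l * pd (pd (fun w => ν w k) p) j w) := by
  have hd : ∀ k, HasFDerivAt (fun w => ν w k) (fderiv ℝ (fun w => ν w k) w) w := fun k =>
    (((contDiffOn_pi.1 hν.smooth k).contDiffAt (hV.mem_nhds hw)).differentiableAt
      (by simp)).hasFDerivAt
  have hJ : ∀ k, HasFDerivAt (fun w => jacobian ν w k p)
      (fderiv ℝ (fun w => jacobian ν w k p) w) w := fun k =>
    (((hν.contDiffOn_jacobian hV k p).contDiffAt (hV.mem_nhds hw)).differentiableAt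
      (by simp)).hasFDerivAt
  have h1 := (HasFDerivAt.fun_sum (u := Finset.univ) fun k _ => HasFDerivAt.fun_sum
    (u := Finset.univ) fun l _ => ((hd l).const_mul (g⁻¹ k l)).fun_mul (hJ k)).fun_neg
  have h2 : pd (flatPotential ν g) p =ᶠ[nhds w]
      fun w => -∑ k, ∑ l, g⁻¹ k l * ν w l * jacobian ν w k p := by
    filter_upwards [hV.mem_nhds hw] with w hw using hν.pd_flatPotential hV hw p
  have h3 := h1.congr_of_eventuallyEq h2
  rw [pd, h3.fderiv]
  simp only [smul_apply, sum_apply, add_apply, neg_apply, smul_eq_mul]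
  congr 1
  refine Finset.sum_congr rfl fun k _ => Finset.sum_congr rfl fun l _ => ?_
  simp only [jacobian_apply]
  ring

/-- Inverting `J α Jᵗ = g` gives `Jᵗ g⁻¹ J = α⁻¹`, the source of `-ε δ_jl` for the quadratic
Casimir. -/
theorem IsFlatCoord.transpose_mul_inv_mul (hν : IsFlatCoord α V ν g) {w : Fin m → ℝ}
    (hw : w ∈ V) : (jacobian ν w).transpose * g⁻¹ * jacobian ν w * α w = 1 := by
  have hJ : IsUnit (jacobian ν w).transpose.det := by
    rw [Matrix.det_transpose]
    exact (hν.invertible w hw).isUnit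
  have h1 : (jacobian ν w).transpose * g⁻¹ * jacobian ν w * α w * (jacobian ν w).transpose =
      (jacobian ν w).transpose := by
    rw [Matrix.mul_assoc _ (jacobian ν w), Matrix.mul_assoc _ _ (jacobian ν w).transpose,
      hν.flat w hw, Matrix.mul_assoc, Matrix.nonsing_inv_mul _ hν.nondeg.isUnit, Matrix.mul_one]
  have h2 := congrArg (fun M => M * ((jacobian ν w).transpose)⁻¹) h1
  simpa only [Matrix.mul_assoc, Matrix.mul_nonsing_inv _ hJ, Matrix.mul_one] using h2

theorem isCasimir_rhoDensity (hV : IsOpen V) :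
    IsCasimir (fieldDomain V) (decBracket α β) rhoDensity := by
  rw [rhoDensity_eq]
  refine isCasimir_affineDensity hV 0 contDiffOn_const fun w _ l j => ?_
  have h0 : ∀ k : Fin m, pd (fun _ : Fin m → ℝ => (1 : ℝ)) k = fun _ => 0 := fun k => by
    funext w
    simp [pd]
  simp only [h0]
  simp [pd]

namespace IsFlatBracket

variable (h : IsFlatBracket α β W)
include h

theorem isCasimir_rhoNuDensity (hV : IsOpen V) (hVW : V ⊆ W) (hν : IsFlatCoord α V ν g)
    (k : Fin m) : IsCasimir (fieldDomain V) (decBracket α β) (rhoNuDensity ν k) := by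
  rw [rhoNuDensity_eq]
  refine isCasimir_affineDensity hV 0 (contDiffOn_pi.1 hν.smooth k) fun w hw l j => ?_
  rw [neg_zero, ite_self]
  exact h.hessian_flatCoord hV hVW hν hw k l j

/-- By the product rule, the terms in which `ν` stays undifferentiated are combinations of the
expressions in `hessian_flatCoord` and vanish. Those with both factors `ν` differentiated give `-Jᵗ
g⁻¹ J α = -1`, which matches `ε = 1`. -/
theorem isCasimir_psiDensity (hV : IsOpen V) (hVW : V ⊆ W) (hν : IsFlatCoord α V ν g) :
    IsCasimir (fieldDomain V) (decBracket α β) (psiDensity ν g) := by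
  rw [psiDensity_eq]
  refine isCasimir_affineDensity hV 1 hν.contDiffOn_flatPotential fun w hw l j => ?_
  have h1 : ∀ p, pd (pd (flatPotential ν g) p) j w * α w p l +
      pd (flatPotential ν g) p w * β w p l j =
      -((∑ k, ∑ n, g⁻¹ k n * jacobian ν w n j * jacobian ν w k p * α w p l) +
        ∑ k, ∑ n, g⁻¹ k n * ν w n * (pd (pd (fun w => ν w k) p) j w * α w p l +
          jacobian ν w k p * β w p l j)) := by
    intro p
    rw [hν.pd_pd_flatPotential hV hw, hν.pd_flatPotential hV hw, neg_mul, neg_mul,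
      ← neg_add, Finset.sum_mul, Finset.sum_mul, ← Finset.sum_add_distrib,
      ← Finset.sum_add_distrib]
    congr 1
    refine Finset.sum_congr rfl fun k _ => ?_
    rw [Finset.sum_mul, Finset.sum_mul, ← Finset.sum_add_distrib, ← Finset.sum_add_distrib]
    exact Finset.sum_congr rfl fun n _ => by ring
  have h2 : (∑ p, ∑ k, ∑ n, g⁻¹ k n * ν w n * (pd (pd (fun w => ν w k) p) j w * α w p l +
      jacobian ν w k p * β w p l j)) = 0 := by
    rw [Finset.sum_comm]
    refine Finset.sum_eq_zero fun k _ => ?_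
    rw [Finset.sum_comm]
    refine Finset.sum_eq_zero fun n _ => ?_
    rw [← Finset.mul_sum, h.hessian_flatCoord hV hVW hν hw, mul_zero]
  have h3 : (∑ p, ∑ k, ∑ n, g⁻¹ k n * jacobian ν w n j * jacobian ν w k p * α w p l) =
      (1 : Matrix (Fin m) (Fin m) ℝ) j l := by
    rw [← hν.transpose_mul_inv_mul hw, Matrix.mul_apply]
    refine Finset.sum_congr rfl fun p _ => ?_
    rw [Matrix.mul_apply, Finset.sum_mul]
    refine Finset.sum_congr rfl fun k _ => ?_
    rw [Matrix.mul_apply, Finset.sum_mul, Finset.sum_mul]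
    refine Finset.sum_congr rfl fun n _ => ?_
    rw [hν.inv_symm k n, Matrix.transpose_apply]
    ring
  simp only [h1, Finset.sum_neg_distrib, Finset.sum_add_distrib]
  rw [h2, h3, add_zero, Matrix.one_apply]
  split_ifs <;> simp

end IsFlatBracket

/-- The functional derivatives of the Casimir densities are linearly independent. -/
theorem IsFlatCoord.areIndependent (hV : IsOpen V) (hν : IsFlatCoord α V ν g) :
    AreIndependent (fieldDomain V)
      (Sum.elim ![rhoDensity, psiDensity ν g] (rhoNuDensity ν)) := by
  intro x z hz
  have hρ : z 0 iρ ≠ 0 := hz.1.ne'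
  rw [Fintype.linearIndependent_iff]
  intro c hc
  have hνs := contDiffOn_pi.1 hν.smooth
  have key : ∀ i, c iρ * varDeriv i rhoDensity x z + c iu * varDeriv i (psiDensity ν g) x z +
      ∑ k, c (iw k) * varDeriv i (rhoNuDensity ν k) x z = 0 := by
    intro i
    have h1 := congrFun hc i
    simpa [Fintype.sum_sum_type, Fin.sum_univ_two] using h1
  simp only [rhoDensity_eq, psiDensity_eq, rhoNuDensity_eq] at key
  -- The system is triangular: only `psiDensity` has a `u`-derivative. Once its coefficient is gone,
  -- the `w`-derivatives are rows of `ρ J`, and finally only `ρ` itself is left.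
  have hu : c iu = 0 := by
    have h1 := key iu
    simp only [varDeriv_iu_affineDensity hV _ _ hz] at h1
    simpa using h1
  have hw : ∀ k, c (iw k) = 0 := by
    have h1 : Matrix.vecMul (fun k => c (iw k)) (jacobian ν (wval z)) = 0 := by
      funext p
      have h2 := key (iw p)
      rw [hu, varDeriv_iw_affineDensity hV _ contDiffOn_const p hz] at h2
      simp only [varDeriv_iw_affineDensity hV _ (hνs _) p hz] at h2
      have h3 : z 0 iρ * ∑ k, c (iw k) * jacobian ν (wval z) k p = 0 := by
        rw [← h2, Finset.mul_sum]
        simp only [pd, fderiv_fun_const, Pi.zero_apply, zero_apply, mul_zero, zero_mul, zero_add]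
        refine Finset.sum_congr rfl fun k _ => ?_
        rw [jacobian_apply]
        ring
      exact (mul_eq_zero.1 h3).resolve_left hρ
    exact congrFun (Matrix.eq_zero_of_vecMul_eq_zero (hν.invertible _ hz.2) h1)
  have hr : c iρ = 0 := by
    have h1 := key iρ
    simp only [varDeriv_iρ_affineDensity hV _ _ hz, hu, hw] at h1
    simpa using h1
  rintro (i | k)
  · fin_cases i
    · exact hr
    · exact hu
  · exact hw k

end Casimirs

end HydroBracket

theorem mainTheorem9 (m : ℕ) (W : Set (Fin m → ℝ)) (hW : IsOpen W)
    (α : (Fin m → ℝ) → Matrix (Fin m) (Fin m) ℝ)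
    (β : (Fin m → ℝ) → Fin m → Fin m → Fin m → ℝ)
    (hα : ∀ k l, ContDiffOn ℝ ∞ (fun w => α w k l) W)
    (hβ : ∀ k l j, ContDiffOn ℝ ∞ (fun w => β w k l j) W)
    (hsymm : ∀ w ∈ W, (α w).IsSymm)
    (hnondeg : ∀ v ∈ fieldDomain W, (decMetric α v).det ≠ 0)
    (hPoisson : IsPoisson (fieldDomain W) (decBracket α β)) :
    -- flat coordinates of the microscopic bracket exist around every point
    (∀ w₀ ∈ W, ∃ (V : Set (Fin m → ℝ)) (ν : (Fin m → ℝ) → Fin m → ℝ)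
      (g : Matrix (Fin m) (Fin m) ℝ),
      IsOpen V ∧ w₀ ∈ V ∧ V ⊆ W ∧ Set.InjOn ν V ∧ IsFlatCoord α V ν g) ∧
    -- and all flat coordinates give `m + 2` independent Casimir invariants
    (∀ (V : Set (Fin m → ℝ)) (ν : (Fin m → ℝ) → Fin m → ℝ) (g : Matrix (Fin m) (Fin m) ℝ),
      IsOpen V → V ⊆ W → IsFlatCoord α V ν g →
      (∀ w ∈ V, ∀ k l j, transformedBeta α β ν w k l j = 0) ∧
      IsCasimir (fieldDomain V) (decBracket α β) rhoDensity ∧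
      IsCasimir (fieldDomain V) (decBracket α β) (psiDensity ν g) ∧
      (∀ k, IsCasimir (fieldDomain V) (decBracket α β) (rhoNuDensity ν k)) ∧
      AreIndependent (fieldDomain V)
        (Sum.elim ![rhoDensity, psiDensity ν g] (rhoNuDensity ν))) := by
  have h := hPoisson.isFlatBracket hW hα hβ hsymm fun w hw => det_ne_zero_of_decMetric hnondeg hw
  refine ⟨fun w₀ hw₀ => h.exists_isFlatCoord hw₀, fun V ν g hV hVW hν => ⟨?_, ?_, ?_, ?_, ?_⟩⟩
  · exact fun w hw k l j => h.transformedBeta_eq_zero hV hVW hν hw k l j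
  · exact isCasimir_rhoDensity hV
  · exact h.isCasimir_psiDensity hV hVW hν
  · exact fun k => h.isCasimir_rhoNuDensity hV hVW hν k
  · exact hν.areIndependent hV
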